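/- Let $n\ge 0$, $\alpha\in[0,\pi/2)$, and let $A,B$ be complex $n\times n$ matrices whose numerical ranges $\{\langle Ax,x\rangle:\|x\|=1\}$ and $\{\langle Bx,x\rangle:\|x\|=1\}$ are contained in the sector $\{z\in\mathbb C:\Re z\ge 0,\ |\Im z|\le \tan(\alpha)\,\Re z\}$. Write $\Re X=\frac{X+X^*}{2}$, and for Hermitian matrices let $X\ge Y$ mean that $X-Y$ is positive semidefinite. Suppose that $hI\le \Re A\le kI$ and $hI\le\Re B\le kI$ for some real numbers $0<h<k$. Let $\mu\ge 0$, $\lambda\in[0,1]$ and $t=\min\{\lambda,1-\lambda\}$, and put $$\gamma=\arctan\frac{\tan\alpha}{1+\mu},\qquad k^*=(k+\mu)^{-1},\qquad h^*=(h+\mu)^{-1},\qquad C=\left(\frac{(1-t)k^*+t\,h^*}{(k^*)^{1-t}(h^*)^{t}}\right)^{-1}.$$ Let $$\mathcal R_\mu(A,B,1-\lambda,\lambda)=\bigl((1-\lambda)(A+\mu I)^{-1}+\lambda(B+\mu I)^{-1}\bigr)^{-1}-\mu I$$ be the weighted resolvent average and $$A\sharp_\lambda B=A^{1/2}\bigl(A^{-1/2}BA^{-1/2}\bigr)^{\lambda}A^{1/2}$$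 the weighted geometric mean, where the powers are principal powers, $X^p=\exp(p\log X)$ with $\log$ the principal logarithm of a matrix that has no eigenvalue in $(-\infty,0]$. Then $$\Re\bigl(\mathcal R_\mu(A,B,1-\lambda,\lambda)\bigr)+\mu I\ \ge\ C\cos^2\gamma\,\bigl(\cos^2\alpha\;\Re(A\sharp_\lambda B)+\mu I\bigr).$$ -/

import Mathlib

open scoped MatrixOrder ComplexOrder

/-- The numerical range `{⟨A x, x⟩ : ‖x‖ = 1}` of a complex square matrix. -/
def numericalRange {n : ℕ} (A : Matrix (Fin n) (Fin n) ℂ) : Set ℂ :=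
  {z | ∃ x : Fin n → ℂ, star x ⬝ᵥ x = 1 ∧ z = star x ⬝ᵥ A.mulVec x}

/-- The sector `S_α = {z : Re z ≥ 0, |Im z| ≤ tan α · Re z}`. -/
def sector (α : ℝ) : Set ℂ :=
  {z | 0 ≤ z.re ∧ |z.im| ≤ Real.tan α * z.re}

/-- The class `Π_{n,α}` of matrices whose numerical range lies in `S_α`. -/
def sectorialMatrices (n : ℕ) (α : ℝ) : Set (Matrix (Fin n) (Fin n) ℂ) :=
  {A | numericalRange A ⊆ sector α}

/-- The real part `(A + A*) / 2` (Mathlib's `realPart`), as a matrix. -/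
noncomputable def matRe {n : ℕ} (A : Matrix (Fin n) (Fin n) ℂ) : Matrix (Fin n) (Fin n) ℂ :=
  (realPart A : Matrix (Fin n) (Fin n) ℂ)

/-- The principal logarithm of a matrix without eigenvalues in `(-∞, 0]`. It is the principal
branch `log z = ∫₀¹ (z - 1) / (1 + s (z - 1)) ds` (for `z ∈ ℂ ∖ (-∞, 0]`) applied to `X`; the
integral is taken entrywise. -/
noncomputable def matLog {n : ℕ} (X : Matrix (Fin n) (Fin n) ℂ) : Matrix (Fin n) (Fin n) ℂ :=
  Matrix.of fun i j => ∫ s in (0 : ℝ)..1, ((X - 1) * (1 + s • (X - 1))⁻¹) i j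

/-- The principal power `X ^ p = exp (p log X)` of a matrix without eigenvalues in `(-∞, 0]`. -/
noncomputable def matPow {n : ℕ} (X : Matrix (Fin n) (Fin n) ℂ) (p : ℝ) :
    Matrix (Fin n) (Fin n) ℂ :=
  NormedSpace.exp (p • matLog X)

/-- The weighted geometric mean `A ♯_l B = A^{1/2} (A^{-1/2} B A^{-1/2})^l A^{1/2}`. -/
noncomputable def geomMean {n : ℕ} (l : ℝ) (A B : Matrix (Fin n) (Fin n) ℂ) :
    Matrix (Fin n) (Fin n) ℂ :=
  matPow A (1 / 2) * matPow (matPow A (-(1 / 2)) * B * matPow A (-(1 / 2))) l * matPow A (1 / 2)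

/-- The resolvent average `R_μ(A, w) = (∑ i, w i (A i + μ I)⁻¹)⁻¹ - μ I`. -/
noncomputable def resolventAverage {n m : ℕ} (μ : ℝ) (A : Fin m → Matrix (Fin n) (Fin n) ℂ)
    (w : Fin m → ℝ) : Matrix (Fin n) (Fin n) ℂ :=
  (∑ i, w i • (A i + μ • (1 : Matrix (Fin n) (Fin n) ℂ))⁻¹)⁻¹ - μ • 1

/-- The weighted arithmetic mean `a ∇_t b = (1 - t) a + t b` of real numbers. -/
noncomputable def realArithMean (t a b : ℝ) : ℝ := (1 - t) * a + t * b

/-- The weighted geometric mean `a ♯_t b = a^{1-t} b^t` of positive real numbers. -/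
noncomputable def realGeomMean (t a b : ℝ) : ℝ := a ^ (1 - t) * b ^ t

/-- The constant `C = ((k* ∇_t h*) / (k* ♯_t h*))⁻¹`, where `k* = (k + μ)⁻¹`, `h* = (h + μ)⁻¹` and
`t = min {l, 1 - l}`. -/
noncomputable def kantorovichConst (h k μ l : ℝ) : ℝ :=
  (realArithMean (min l (1 - l)) (k + μ)⁻¹ (h + μ)⁻¹ /
    realGeomMean (min l (1 - l)) (k + μ)⁻¹ (h + μ)⁻¹)⁻¹

/-- The angle `γ = arctan (tan α / (1 + |μ|))`. -/
noncomputable def shiftedAngle (α μ : ℝ) : ℝ := Real.arctan (Real.tan α / (1 + |μ|))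

/-! Write H_u(X, Y) = (u X⁻¹ + (1-u) Y⁻¹)⁻¹, and let w be the Beta density σ ↦ (1-σ)^(l-1) σ^(-l) on
(0, 1), with mass m. For 0 < l < 1 everything rests on the formula m · (A ♯_l B) = ∫ w(u) H_u(A, B)
du (`betaMass_smul_geomMean`), valid for all A, B with positive definite real part. It turns
statements about the geometric mean of non-Hermitian matrices into statements about harmonic means,
which are controlled by quadratic forms.

For positive definite P, Q the form of a harmonic mean at v is the minimum of a⟨Px,x⟩ + b⟨Qy,y⟩ over
v = ax + by (`quadRe_harmMean_le`, `exists_quadRe_harmMean_eq`). This variational principle gives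
H(Re A, Re B) ≤ Re H(A, B), and superadditivity under adding μI. Together with Re(A⁻¹) ≥ cos²α (Re
A)⁻¹ for sectorial A (`quadRe_inv_matRe_le`), a similar duality argument gives cos²α Re H(A, B) ≤
H(Re A, Re B).

Put P = Re A + μI and Q = Re B + μI, both between h+μ and k+μ. Integrating the last two facts
against w gives m(cos²α Re(A ♯_l B) + μI) ≤ ∫ w H_u(P, Q). Simultaneous diagonalization of P and Q
reduces C ∫ w H_u(P, Q) ≤ m ((1-l)P⁻¹ + lQ⁻¹)⁻¹ to a scalar reverse mean inequality
(`kantorovichConst_mul_integral_le`). Finally ((1-l)P⁻¹ + lQ⁻¹)⁻¹ is at most the real part of the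
harmonic mean of A+μI and B+μI, which is the left side of the claim. The mass m cancels and is never
evaluated. The factor cos²γ ≤ 1 only weakens the resulting bound. -/

open Set MeasureTheory Filter Topology
open Matrix

/-! ### Logarithm along a segment and the differential equation of powers. -/

section BanachAlgebra

variable {𝔸 : Type*} [NormedRing 𝔸] [NormedAlgebra ℝ 𝔸]

/-- The resolvent-type function `u ↦ (1 + u D)⁻¹`. -/
noncomputable def segInv (D : 𝔸) (u : ℝ) : 𝔸 := Ring.inverse (1 + u • D)

/-- The integral `∫₀ʳ D (1 + s D)⁻¹ ds`, which is `log (1 + r D)`. -/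
noncomputable def segLog (D : 𝔸) (r : ℝ) : 𝔸 := ∫ s in (0 : ℝ)..r, D * segInv D s

theorem Commute.segInv_right {Z D : 𝔸} (h : Commute Z D) (u : ℝ) : Commute Z (segInv D u) := by
  have : Commute Z (1 + u • D) := (Commute.one_right Z).add_right (h.smul_right u)
  by_cases hu : IsUnit (1 + u • D)
  · obtain ⟨x, hx⟩ := hu
    rw [segInv, ← hx, Ring.inverse_unit]
    rw [← hx] at this
    exact this.units_inv_right
  · rw [segInv, Ring.inverse_non_unit _ hu]
    exact Commute.zero_right Z

theorem commute_segInv (D : 𝔸) (u : ℝ) : Commute D (segInv D u) :=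
  (Commute.refl D).segInv_right u

theorem segInv_mul_cancel {D : 𝔸} {u : ℝ} (h : IsUnit (1 + u • D)) :
    segInv D u * (1 + u • D) = 1 := Ring.inverse_mul_cancel _ h

theorem mul_segInv_cancel {D : 𝔸} {u : ℝ} (h : IsUnit (1 + u • D)) :
    (1 + u • D) * segInv D u = 1 := Ring.mul_inverse_cancel _ h

theorem segInv_zero (D : 𝔸) : segInv D 0 = 1 := by simp [segInv]

theorem segLog_zero (D : 𝔸) : segLog D 0 = 0 := by simp [segLog]

variable [CompleteSpace 𝔸]

theorem hasDerivAt_segInv {D : 𝔸} {u : ℝ} (h : IsUnit (1 + u • D)) :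
    HasDerivAt (segInv D) (-(segInv D u * D * segInv D u)) u := by
  obtain ⟨x, hx⟩ := h
  have h1 : HasDerivAt (fun v : ℝ => 1 + v • D) D u := by
    simpa using ((hasDerivAt_id u).smul_const D).const_add 1
  have h2 := hasFDerivAt_ringInverse (𝕜 := ℝ) x
  rw [hx] at h2
  have h3 := h2.comp_hasDerivAt u h1
  have hi : segInv D u = ↑x⁻¹ := by rw [segInv, ← hx, Ring.inverse_unit]
  rw [hi]
  simpa [Function.comp_def] using! h3

theorem continuousOn_segInv {D : 𝔸} (h : ∀ u ∈ Icc (0 : ℝ) 1, IsUnit (1 + u • D)) :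
    ContinuousOn (segInv D) (Icc 0 1) := fun u hu =>
  (hasDerivAt_segInv (h u hu)).continuousAt.continuousWithinAt

theorem continuousOn_mul_segInv {D : 𝔸} (h : ∀ u ∈ Icc (0 : ℝ) 1, IsUnit (1 + u • D)) :
    ContinuousOn (fun s => D * segInv D s) (Icc 0 1) :=
  continuousOn_const.mul (continuousOn_segInv h)

theorem intervalIntegrable_mul_segInv {D : 𝔸} (h : ∀ u ∈ Icc (0 : ℝ) 1, IsUnit (1 + u • D))
    {r : ℝ} (hr : r ∈ Icc (0 : ℝ) 1) :
    IntervalIntegrable (fun s => D * segInv D s) volume 0 r := by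
  apply ContinuousOn.intervalIntegrable
  rw [uIcc_of_le hr.1]
  exact (continuousOn_mul_segInv h).mono (Icc_subset_Icc_right hr.2)

theorem continuousOn_segLog {D : 𝔸} (h : ∀ u ∈ Icc (0 : ℝ) 1, IsUnit (1 + u • D)) :
    ContinuousOn (segLog D) (Icc 0 1) := by
  have := intervalIntegral.continuousOn_primitive_interval
    (μ := volume) (f := fun s => D * segInv D s) (a := 0) (b := 1) (by
      rw [uIcc_of_le zero_le_one]
      exact (continuousOn_mul_segInv h).integrableOn_Icc)
  rwa [uIcc_of_le zero_le_one] at this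

theorem hasDerivAt_segLog {D : 𝔸} (h : ∀ u ∈ Icc (0 : ℝ) 1, IsUnit (1 + u • D))
    {r : ℝ} (hr : r ∈ Ioo (0 : ℝ) 1) : HasDerivAt (segLog D) (D * segInv D r) r := by
  have hn : Icc (0 : ℝ) 1 ∈ 𝓝 r := Icc_mem_nhds hr.1 hr.2
  refine intervalIntegral.integral_hasDerivAt_right
    (intervalIntegrable_mul_segInv h (Ioo_subset_Icc_self hr)) ?_
    ((continuousOn_mul_segInv h).continuousAt hn)
  exact ⟨Icc 0 1, hn, (continuousOn_mul_segInv h).aestronglyMeasurable measurableSet_Icc⟩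

theorem commute_segLog {Z D : 𝔸} (h : ∀ u ∈ Icc (0 : ℝ) 1, IsUnit (1 + u • D)) (hZ : Commute Z D)
    {r : ℝ} (hr : r ∈ Icc (0 : ℝ) 1) : Commute Z (segLog D r) := by
  have hi := intervalIntegrable_mul_segInv h hr
  have h1 := (ContinuousLinearMap.mul ℝ 𝔸 Z).intervalIntegral_comp_comm hi
  have h2 := ((ContinuousLinearMap.mul ℝ 𝔸).flip Z).intervalIntegral_comp_comm hi
  simp only [ContinuousLinearMap.mul_apply', ContinuousLinearMap.flip_apply] at h1 h2
  rw [Commute, SemiconjBy, segLog, ← h1, ← h2]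
  refine intervalIntegral.integral_congr fun s _ => ?_
  exact (hZ.mul_right (hZ.segInv_right s)).eq

theorem commute_segLog_segLog {D : 𝔸} (h : ∀ u ∈ Icc (0 : ℝ) 1, IsUnit (1 + u • D))
    {r s : ℝ} (hr : r ∈ Icc (0 : ℝ) 1) (hs : s ∈ Icc (0 : ℝ) 1) :
    Commute (segLog D r) (segLog D s) :=
  commute_segLog h (commute_segLog h (Commute.refl D) hr).symm hs

/-- The values of `segLog D` commute with one another, so exp(p L(x)) = exp(p L(r)) exp(p (L(x) -
L(r))) and only the derivative of exp at 0 is needed. -/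
theorem hasDerivAt_exp_smul_segLog {D : 𝔸} (h : ∀ u ∈ Icc (0 : ℝ) 1, IsUnit (1 + u • D)) (p : ℝ)
    {r : ℝ} (hr : r ∈ Ioo (0 : ℝ) 1) :
    HasDerivAt (fun x => NormedSpace.exp (p • segLog D x))
      (NormedSpace.exp (p • segLog D r) * (p • (D * segInv D r))) r := by
  let _ : NormedAlgebra ℚ 𝔸 := NormedAlgebra.restrictScalars ℚ ℝ 𝔸
  have h1 : HasDerivAt (fun x => p • segLog D x - p • segLog D r) (p • (D * segInv D r)) r :=
    ((hasDerivAt_segLog h hr).const_smul p).sub_const _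
  have h2 : HasFDerivAt NormedSpace.exp (1 : 𝔸 →L[ℝ] 𝔸) (p • segLog D r - p • segLog D r) := by
    rw [sub_self]; exact hasFDerivAt_exp_zero
  have h3 := (h2.comp_hasDerivAt r h1).const_mul (NormedSpace.exp (p • segLog D r))
  refine (h3.congr_of_eventuallyEq ?_)
  filter_upwards [Icc_mem_nhds hr.1 hr.2] with x hx
  have hc : Commute (p • segLog D r) (p • segLog D x - p • segLog D r) := by
    have := commute_segLog_segLog h (Ioo_subset_Icc_self hr) hx
    exact ((this.smul_left p).smul_right p).sub_right (Commute.refl _)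
  rw [Function.comp_apply, ← NormedSpace.exp_add_of_commute hc]
  congr 1
  abel

/-- Uniqueness for a linear differential equation: exp(-p L) F has derivative zero on (0, 1), so it
keeps its initial value 1. This is the tool for recognising a function as a power of 1 + D. -/
theorem eq_exp_smul_segLog {D : 𝔸} (h : ∀ u ∈ Icc (0 : ℝ) 1, IsUnit (1 + u • D)) (p : ℝ)
    {F : ℝ → 𝔸} (hF : ContinuousOn F (Icc 0 1)) (h0 : F 0 = 1)
    (hF' : ∀ r ∈ Ioo (0 : ℝ) 1, HasDerivAt F (p • (D * segInv D r * F r)) r) :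
    F 1 = NormedSpace.exp (p • segLog D 1) := by
  let _ : NormedAlgebra ℚ 𝔸 := NormedAlgebra.restrictScalars ℚ ℝ 𝔸
  have hder : ∀ r ∈ Ioo (0 : ℝ) 1,
      HasDerivAt (fun x => NormedSpace.exp ((-p) • segLog D x) * F x) 0 r := by
    intro r hr
    have h1 := (hasDerivAt_exp_smul_segLog h (-p) hr).mul (hF' r hr)
    refine h1.congr_deriv ?_
    generalize NormedSpace.exp (-p • segLog D r) = E
    simp only [mul_smul_comm, smul_mul_assoc, neg_smul, mul_assoc, mul_neg, neg_mul,
      neg_add_cancel]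
  have hcont : ContinuousOn (fun x => NormedSpace.exp ((-p) • segLog D x) * F x) (Icc 0 1) :=
    (NormedSpace.exp_continuous.comp_continuousOn
      ((continuousOn_segLog h).const_smul (-p))).mul hF
  have h1 := intervalIntegral.integral_eq_sub_of_hasDerivAt_of_le zero_le_one hcont hder
    (by simp)
  simp only [intervalIntegral.integral_zero, segLog_zero, smul_zero, NormedSpace.exp_zero, h0,
    mul_one] at h1
  have h2 : NormedSpace.exp ((-p) • segLog D 1) * F 1 = 1 := (sub_eq_zero.mp h1.symm)
  have h3 : NormedSpace.exp (p • segLog D 1) * NormedSpace.exp ((-p) • segLog D 1) = 1 := by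
    rw [← NormedSpace.exp_add_of_commute
      (((Commute.refl (segLog D 1)).smul_left p).smul_right (-p)), neg_smul, add_neg_cancel,
      NormedSpace.exp_zero]
  calc F 1 = NormedSpace.exp (p • segLog D 1) * NormedSpace.exp ((-p) • segLog D 1) * F 1 := by
        rw [h3, one_mul]
    _ = _ := by rw [mul_assoc, h2, mul_one]

theorem exp_segLog {D : 𝔸} (h : ∀ u ∈ Icc (0 : ℝ) 1, IsUnit (1 + u • D)) :
    NormedSpace.exp (segLog D 1) = 1 + D := by
  have hd : ∀ r : ℝ, HasDerivAt (fun v : ℝ => 1 + v • D) D r := fun r => by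
    simpa using ((hasDerivAt_id r).smul_const D).const_add 1
  have := eq_exp_smul_segLog h 1 (F := fun v : ℝ => 1 + v • D) (by fun_prop) (by simp)
    (fun r hr => by
      have hu := segInv_mul_cancel (h r (Ioo_subset_Icc_self hr))
      refine (hd r).congr_deriv ?_
      rw [one_smul, mul_assoc, hu, mul_one])
  simpa using this.symm

end BanachAlgebra

/-! ### Beta-integral representation of fractional powers. -/

/-- The (unnormalised) Beta density `(1 - σ) ^ (l - 1) σ ^ (-l)`. -/
noncomputable def betaWeight (l σ : ℝ) : ℝ := (1 - σ) ^ (l - 1) * σ ^ (-l)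

theorem betaWeight_nonneg {l σ : ℝ} (hσ : σ ∈ Icc (0 : ℝ) 1) : 0 ≤ betaWeight l σ :=
  mul_nonneg (Real.rpow_nonneg (by linarith [hσ.2]) _) (Real.rpow_nonneg hσ.1 _)

theorem betaWeight_pos {l σ : ℝ} (hσ : σ ∈ Ioo (0 : ℝ) 1) : 0 < betaWeight l σ :=
  mul_pos (Real.rpow_pos_of_pos (by linarith [hσ.2]) _) (Real.rpow_pos_of_pos hσ.1 _)

theorem intervalIntegrable_betaWeight {l : ℝ} (h0 : 0 < l) (h1 : l < 1) :
    IntervalIntegrable (betaWeight l) volume 0 1 := by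
  have h := Complex.betaIntegral_convergent (u := ((1 - l : ℝ) : ℂ)) (v := (l : ℂ))
    (by rw [Complex.ofReal_re]; linarith) (by simpa using h0)
  refine h.norm.congr fun σ hσ => ?_
  rw [uIoc_of_le zero_le_one] at hσ
  have e1 : ((σ : ℂ)) ^ (((1 - l : ℝ) : ℂ) - 1) = ((σ ^ (-l) : ℝ) : ℂ) := by
    rw [Complex.ofReal_cpow hσ.1.le]; congr 1; push_cast; ring
  have e2 : (1 - (σ : ℂ)) ^ ((l : ℂ) - 1) = (((1 - σ) ^ (l - 1) : ℝ) : ℂ) := by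
    rw [Complex.ofReal_cpow (by linarith [hσ.2])]; push_cast; rfl
  simp only [e1, e2]
  rw [← Complex.ofReal_mul, Complex.norm_real, mul_comm, Real.norm_of_nonneg]
  · rfl
  · exact betaWeight_nonneg ⟨hσ.1.le, hσ.2⟩

/-- The normalising constant of the Beta density. -/
noncomputable def betaMass (l : ℝ) : ℝ := ∫ σ in (0 : ℝ)..1, betaWeight l σ

theorem betaMass_pos {l : ℝ} (h0 : 0 < l) (h1 : l < 1) : 0 < betaMass l :=
  intervalIntegral.intervalIntegral_pos_of_pos_on (intervalIntegrable_betaWeight h0 h1)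
    (fun _ h => betaWeight_pos h) zero_lt_one

section BanachAlgebra

variable {𝔸 : Type*} [NormedRing 𝔸] [NormedAlgebra ℝ 𝔸]

theorem intervalIntegrable_betaWeight_smul {l : ℝ} (h0 : 0 < l) (h1 : l < 1)
    {f : ℝ → 𝔸} (hf : ContinuousOn f (Icc 0 1)) :
    IntervalIntegrable (fun σ => betaWeight l σ • f σ) volume 0 1 :=
  (intervalIntegrable_betaWeight h0 h1).smul_continuousOn (by rwa [uIcc_of_le zero_le_one])

variable [CompleteSpace 𝔸]

theorem mul_mem_unitInterval {r σ : ℝ} (hr : r ∈ Icc (0 : ℝ) 1) (hσ : σ ∈ Icc (0 : ℝ) 1) :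
    r * σ ∈ Icc (0 : ℝ) 1 :=
  ⟨mul_nonneg hr.1 hσ.1, mul_le_one₀ hr.2 hσ.1 hσ.2⟩

theorem continuousOn_segInv_mul {D : 𝔸} (h : ∀ u ∈ Icc (0 : ℝ) 1, IsUnit (1 + u • D))
    {r : ℝ} (hr : r ∈ Icc (0 : ℝ) 1) : ContinuousOn (fun σ => segInv D (r * σ)) (Icc 0 1) :=
  (continuousOn_segInv h).comp (by fun_prop) fun _ hσ => mul_mem_unitInterval hr hσ

theorem hasDerivAt_betaWeight_primitive {l σ : ℝ} (hσ : σ ∈ Ioo (0 : ℝ) 1) :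
    HasDerivAt (fun x : ℝ => (1 - x) ^ l * x ^ (1 - l)) (betaWeight l σ * (1 - l - σ)) σ := by
  have hp : 0 < 1 - σ := by linarith [hσ.2]
  have h1 : HasDerivAt (fun x : ℝ => (1 - x) ^ l) _ σ :=
    ((hasDerivAt_id σ).const_sub 1).rpow_const (Or.inl hp.ne')
  have h2 : HasDerivAt (fun x : ℝ => x ^ (1 - l)) _ σ :=
    (hasDerivAt_id σ).rpow_const (Or.inl hσ.1.ne')
  refine (h1.mul h2).congr_deriv ?_
  have e1 : (1 - σ) ^ l = (1 - σ) ^ (l - 1) * (1 - σ) := by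
    rw [← Real.rpow_add_one hp.ne', sub_add_cancel]
  have e2 : σ ^ (1 - l) = σ ^ (-l) * σ := by
    rw [← Real.rpow_add_one hσ.1.ne']; congr 1; ring
  simp only [id, e1, e2, betaWeight, show 1 - l - 1 = -l by ring]
  ring

/-- The integrand is the derivative of (1-σ)^l σ^(1-l) (1 + rσD)⁻¹, which vanishes at both ends
because 0 < l < 1. -/
theorem integral_betaWeight_segInv_sq {D : 𝔸} (h : ∀ u ∈ Icc (0 : ℝ) 1, IsUnit (1 + u • D))
    {l : ℝ} (h0 : 0 < l) (h1 : l < 1) {r : ℝ} (hr : r ∈ Icc (0 : ℝ) 1) :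
    ∫ σ in (0 : ℝ)..1, betaWeight l σ •
        ((1 - σ) • (segInv D (r * σ) * segInv D (r * σ)) - l • segInv D (r * σ)) = 0 := by
  have hc := continuousOn_segInv_mul h hr
  have hl : (0:ℝ) < 1 - l := by linarith
  rw [intervalIntegral.integral_eq_sub_of_hasDerivAt_of_le
    (f := fun σ => ((1 - σ) ^ l * σ ^ (1 - l)) • segInv D (r * σ)) zero_le_one]
  · simp [Real.zero_rpow h0.ne', Real.zero_rpow hl.ne']
  · refine ContinuousOn.smul (ContinuousOn.mul ?_ ?_) hc
    · exact (continuousOn_const.sub continuousOn_id).rpow_const fun x _ => Or.inr h0.le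
    · exact continuousOn_id.rpow_const fun x _ => Or.inr hl.le
  · intro σ hσ
    have hu := h _ (mul_mem_unitInterval hr (Ioo_subset_Icc_self hσ))
    have hY : HasDerivAt (fun x => segInv D (r * x)) _ σ :=
      (hasDerivAt_segInv hu).scomp σ ((hasDerivAt_id σ).const_mul r)
    refine ((hasDerivAt_betaWeight_primitive hσ).smul hY).congr_deriv ?_
    have hp : 0 < 1 - σ := by linarith [hσ.2]
    have e1 : (1 - σ) ^ l = (1 - σ) ^ (l - 1) * (1 - σ) := by
      rw [← Real.rpow_add_one hp.ne', sub_add_cancel]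
    have e2 : σ ^ (1 - l) = σ ^ (-l) * σ := by
      rw [← Real.rpow_add_one hσ.1.ne']; congr 1; ring
    have e3 : (1 - σ) ^ l * σ ^ (1 - l) = betaWeight l σ * (1 - σ) * σ := by
      rw [e1, e2, betaWeight]; ring
    -- With Y = (1 + rσD)⁻¹ this is rσ·YD = 1 - Y multiplied by Y; it removes D from the derivative.
    have e4 : (σ * r) • (segInv D (r * σ) * D * segInv D (r * σ)) =
        segInv D (r * σ) - segInv D (r * σ) * segInv D (r * σ) := by
      have h5 := segInv_mul_cancel hu
      rw [mul_add, mul_one, mul_smul_comm] at h5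
      rw [mul_comm σ r, ← smul_mul_assoc, eq_sub_of_add_eq' h5, sub_mul, one_mul]
    rw [e3]
    simp only [mul_one, smul_neg, smul_smul]
    rw [show betaWeight l σ * (1 - σ) * σ * r = (betaWeight l σ * (1 - σ)) * (σ * r) by ring,
      mul_smul (betaWeight l σ * (1 - σ)) (σ * r), e4]
    module
  · apply intervalIntegrable_betaWeight_smul h0 h1
    fun_prop

theorem hasDerivAt_seg_mul_segInv {D : 𝔸} {r σ : ℝ} (hu : IsUnit (1 + (r * σ) • D)) :
    HasDerivAt (fun x : ℝ => (1 + x • D) * segInv D (x * σ))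
      (D * ((1 - σ) • (segInv D (r * σ) * segInv D (r * σ)))) r := by
  have hd : HasDerivAt (fun v : ℝ => 1 + v • D) D r := by
    simpa using ((hasDerivAt_id r).smul_const D).const_add 1
  have hY : HasDerivAt (fun x => segInv D (x * σ)) _ r :=
    HasDerivAt.scomp (h := fun x => x * σ) (g₁ := segInv D) r (hasDerivAt_segInv hu)
      ((hasDerivAt_id r).mul_const σ)
  refine (hd.mul hY).congr_deriv ?_
  have h5 := mul_segInv_cancel hu
  have hc := (commute_segInv D (r * σ)).eq
  generalize segInv D (r * σ) = Y at *
  have h6 : D * Y = D * (Y * Y) + (r * σ) • (D * (D * (Y * Y))) := by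
    calc D * Y = D * (((1 + (r * σ) • D) * Y) * Y) := by rw [h5, one_mul]
      _ = _ := by simp only [add_mul, one_mul, mul_add, smul_mul_assoc, mul_smul_comm, mul_assoc]
  have h7 : Y * D * Y = D * (Y * Y) := by rw [← hc, mul_assoc]
  rw [h7, h6]
  simp only [add_mul, one_mul, smul_mul_assoc, mul_smul_comm, smul_neg, mul_neg]
  module

/-- Scale D by r. The integral F(r) of w(σ)(1 + rD)(1 + rσD)⁻¹ has derivative D ∫ w (1-σ)(1 +
rσD)⁻², which the integration by parts above turns into l·D(1 + rD)⁻¹F(r). So F/m solves the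
equation characterising (1 + rD)^l. -/
theorem exp_smul_segLog_eq_integral {D : 𝔸} (h : ∀ u ∈ Icc (0 : ℝ) 1, IsUnit (1 + u • D))
    {l : ℝ} (h0 : 0 < l) (h1 : l < 1) :
    betaMass l • NormedSpace.exp (l • segLog D 1) =
      ∫ σ in (0 : ℝ)..1, betaWeight l σ • ((1 + D) * segInv D σ) := by
  set F : ℝ → 𝔸 := fun r => ∫ σ in (0 : ℝ)..1, betaWeight l σ • ((1 + r • D) * segInv D (r * σ))
    with hF
  have hm := betaMass_pos h0 h1
  have hcont1 : ∀ r ∈ Icc (0 : ℝ) 1,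
      ContinuousOn (fun σ => (1 + r • D) * segInv D (r * σ)) (Icc 0 1) := fun r hr =>
    continuousOn_const.mul (continuousOn_segInv_mul h hr)
  obtain ⟨M, hM⟩ := isCompact_Icc.exists_bound_of_continuousOn (continuousOn_segInv h)
  have hM0 : 0 ≤ M := (norm_nonneg _).trans (hM 0 (by simp))
  have key := eq_exp_smul_segLog h l (F := fun r => (betaMass l)⁻¹ • F r) ?_ ?_ ?_
  · rw [← key, smul_smul, mul_inv_cancel₀ hm.ne', one_smul, hF]
    simp
  · refine ContinuousOn.const_smul ?_ _
    simp only [hF, intervalIntegral.integral_of_le zero_le_one]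
    -- The bound uses r ≤ 1 for the first factor, and for the second that rσ stays in [0, 1], where
    -- the resolvent is bounded by M.
    refine continuousOn_of_dominated (bound := fun σ => betaWeight l σ * ((‖(1 : 𝔸)‖ + ‖D‖) * M)) ?_ ?_ ?_ ?_
    · intro r hr
      exact (intervalIntegrable_betaWeight_smul h0 h1 (hcont1 r hr)).aestronglyMeasurable
    · intro r hr
      refine (ae_restrict_mem measurableSet_Ioc).mono fun σ hσ => ?_
      have hσ' := Ioc_subset_Icc_self hσ
      rw [norm_smul, Real.norm_of_nonneg (betaWeight_nonneg hσ')]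
      refine mul_le_mul_of_nonneg_left ?_ (betaWeight_nonneg hσ')
      refine (norm_mul_le _ _).trans ?_
      refine mul_le_mul ?_ (hM _ (mul_mem_unitInterval hr hσ')) (norm_nonneg _) (by positivity)
      refine (norm_add_le _ _).trans ?_
      rw [norm_smul, Real.norm_of_nonneg hr.1]
      have := mul_le_of_le_one_left (norm_nonneg D) hr.2
      linarith
    · exact ((intervalIntegrable_betaWeight h0 h1).mul_const _).1
    · refine (ae_restrict_mem measurableSet_Ioc).mono fun σ hσ => ?_
      have hσ' := Ioc_subset_Icc_self hσ
      refine ContinuousOn.const_smul (ContinuousOn.mul (by fun_prop) ?_) _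
      exact (continuousOn_segInv h).comp (by fun_prop) fun r hr => mul_mem_unitInterval hr hσ'
  · simp [hF, segInv_zero, intervalIntegral.integral_smul_const]
    rw [smul_smul, ← betaMass, inv_mul_cancel₀ hm.ne', one_smul]
  · intro r hr
    have hr' := Ioo_subset_Icc_self hr
    have hder := intervalIntegral.hasDerivAt_integral_of_dominated_loc_of_deriv_le
      (μ := volume) (a := 0) (b := 1) (x₀ := r) (s := Ioo 0 1)
      (F := fun r σ => betaWeight l σ • ((1 + r • D) * segInv D (r * σ)))
      (F' := fun r σ => betaWeight l σ •
        (D * ((1 - σ) • (segInv D (r * σ) * segInv D (r * σ)))))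
      (bound := fun σ => betaWeight l σ * (‖D‖ * (M * M)))
      (Ioo_mem_nhds hr.1 hr.2) ?_ ?_ ?_ ?_ ?_ ?_
    · refine (hder.2.const_smul (betaMass l)⁻¹).congr_deriv ?_
      rw [mul_smul_comm, smul_comm l]
      congr 1
      have hz := integral_betaWeight_segInv_sq h h0 h1 hr'
      have hc := continuousOn_segInv_mul h hr'
      have i1 : IntervalIntegrable (fun σ => betaWeight l σ •
          ((1 - σ) • (segInv D (r * σ) * segInv D (r * σ)))) volume 0 1 :=
        intervalIntegrable_betaWeight_smul h0 h1 (by fun_prop)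
      have i2 : IntervalIntegrable (fun σ => betaWeight l σ • segInv D (r * σ)) volume 0 1 :=
        intervalIntegrable_betaWeight_smul h0 h1 hc
      have i3 : IntervalIntegrable (fun σ => l • betaWeight l σ • segInv D (r * σ)) volume 0 1 :=
        i2.smul l
      have hz' : ∫ σ in (0 : ℝ)..1, betaWeight l σ •
          ((1 - σ) • (segInv D (r * σ) * segInv D (r * σ))) =
          l • ∫ σ in (0 : ℝ)..1, betaWeight l σ • segInv D (r * σ) := by
        rw [← sub_eq_zero, ← intervalIntegral.integral_smul,
          ← intervalIntegral.integral_sub i1 i3]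
        refine Eq.trans ?_ hz
        refine intervalIntegral.integral_congr fun σ _ => ?_
        module
      have c1 := (ContinuousLinearMap.mul ℝ 𝔸 D).intervalIntegral_comp_comm i1
      have c2 := (ContinuousLinearMap.mul ℝ 𝔸 (1 + r • D)).intervalIntegral_comp_comm i2
      simp only [ContinuousLinearMap.mul_apply', mul_smul_comm] at c1 c2
      have hFr : F r = (1 + r • D) * ∫ σ in (0 : ℝ)..1, betaWeight l σ • segInv D (r * σ) := by
        rw [← c2]
      simp only [mul_smul_comm] at hz' ⊢
      rw [c1, hz', hFr, mul_smul_comm, ← mul_assoc, mul_assoc D, segInv_mul_cancel (h r hr'),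
        mul_one]
    · filter_upwards [Icc_mem_nhds hr.1 hr.2] with x hx
      have := (intervalIntegrable_betaWeight_smul h0 h1 (hcont1 x hx)).aestronglyMeasurable
      rwa [uIoc_of_le zero_le_one]
    · exact intervalIntegrable_betaWeight_smul h0 h1 (hcont1 r hr')
    · have hc := continuousOn_segInv_mul h hr'
      have := (intervalIntegrable_betaWeight_smul h0 h1 (l := l)
        (f := fun σ => D * ((1 - σ) • (segInv D (r * σ) * segInv D (r * σ))))
        (by fun_prop)).aestronglyMeasurable
      rwa [uIoc_of_le zero_le_one]
    · refine Eventually.of_forall fun σ hσ x hx => ?_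
      rw [uIoc_of_le zero_le_one] at hσ
      have hσ' := Ioc_subset_Icc_self hσ
      have hx' := hM _ (mul_mem_unitInterval (Ioo_subset_Icc_self hx) hσ')
      rw [norm_smul, Real.norm_of_nonneg (betaWeight_nonneg hσ')]
      refine mul_le_mul_of_nonneg_left ?_ (betaWeight_nonneg hσ')
      refine (norm_mul_le _ _).trans (mul_le_mul_of_nonneg_left ?_ (norm_nonneg _))
      rw [norm_smul, Real.norm_of_nonneg (by linarith [hσ.2])]
      refine (mul_le_of_le_one_left (norm_nonneg _) (by linarith [hσ.1])).trans ?_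
      exact (norm_mul_le _ _).trans (mul_le_mul hx' hx' (norm_nonneg _) hM0)
    · exact (intervalIntegrable_betaWeight h0 h1).mul_const _
    · refine Eventually.of_forall fun σ hσ x hx => ?_
      rw [uIoc_of_le zero_le_one] at hσ
      exact (hasDerivAt_seg_mul_segInv (h _ (mul_mem_unitInterval (Ioo_subset_Icc_self hx)
        (Ioc_subset_Icc_self hσ)))).fun_const_smul _

end BanachAlgebra

/-! ### Quadratic forms of accretive and sectorial matrices. -/

section QuadraticForm

variable {n : ℕ}

/-- The real part of the quadratic form `x ↦ x* M x`. -/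
noncomputable def quadRe (M : Matrix (Fin n) (Fin n) ℂ) (v : Fin n → ℂ) : ℝ :=
  (star v ⬝ᵥ M *ᵥ v).re

/-- A matrix whose Hermitian part is positive definite. -/
def IsAccretive (M : Matrix (Fin n) (Fin n) ℂ) : Prop := ∀ v, v ≠ 0 → 0 < quadRe M v

theorem quadRe_add (M N : Matrix (Fin n) (Fin n) ℂ) (v : Fin n → ℂ) :
    quadRe (M + N) v = quadRe M v + quadRe N v := by
  simp [quadRe, add_mulVec]

theorem quadRe_sub (M N : Matrix (Fin n) (Fin n) ℂ) (v : Fin n → ℂ) :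
    quadRe (M - N) v = quadRe M v - quadRe N v := by
  simp [quadRe, sub_mulVec]

theorem quadRe_smul (c : ℝ) (M : Matrix (Fin n) (Fin n) ℂ) (v : Fin n → ℂ) :
    quadRe (c • M) v = c * quadRe M v := by
  simp [quadRe, smul_mulVec]

theorem re_star_dotProduct_comm (v w : Fin n → ℂ) :
    (star v ⬝ᵥ w).re = (star w ⬝ᵥ v).re := by
  have : star v ⬝ᵥ w = star (star w ⬝ᵥ v) := by rw [star_dotProduct]
  rw [this]; simp

theorem star_mulVec_dotProduct (M : Matrix (Fin n) (Fin n) ℂ) (v w : Fin n → ℂ) :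
    star (M *ᵥ v) ⬝ᵥ w = star v ⬝ᵥ Mᴴ *ᵥ w := by
  rw [star_mulVec, ← dotProduct_mulVec]

theorem quadRe_conjTranspose (M : Matrix (Fin n) (Fin n) ℂ) (v : Fin n → ℂ) :
    quadRe Mᴴ v = quadRe M v := by
  rw [quadRe, ← star_mulVec_dotProduct, re_star_dotProduct_comm, quadRe]

theorem matRe_eq (M : Matrix (Fin n) (Fin n) ℂ) : matRe M = (2⁻¹ : ℝ) • (M + Mᴴ) := by
  rw [matRe, realPart_apply_coe, star_eq_conjTranspose]

theorem quadRe_matRe (M : Matrix (Fin n) (Fin n) ℂ) (v : Fin n → ℂ) :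
    quadRe (matRe M) v = quadRe M v := by
  rw [matRe_eq, quadRe_smul, quadRe_add, quadRe_conjTranspose]; ring

theorem isHermitian_matRe (M : Matrix (Fin n) (Fin n) ℂ) : (matRe M).IsHermitian :=
  (realPart M).2

theorem isHermitian_real_smul {M : Matrix (Fin n) (Fin n) ℂ} (hM : M.IsHermitian) (c : ℝ) :
    (c • M).IsHermitian := by
  rw [IsHermitian, conjTranspose_smul, hM.eq, star_trivial]

theorem le_of_quadRe_le {M N : Matrix (Fin n) (Fin n) ℂ} (hM : M.IsHermitian)
    (hN : N.IsHermitian) (h : ∀ v, quadRe M v ≤ quadRe N v) : M ≤ N := by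
  rw [Matrix.le_iff]
  refine PosSemidef.of_dotProduct_mulVec_nonneg (hN.sub hM) fun v => ?_
  rw [Complex.nonneg_iff]
  refine ⟨?_, ?_⟩
  · have := h v
    rw [← sub_nonneg, ← quadRe_sub] at this
    exact this
  · exact ((hN.sub hM).im_star_dotProduct_mulVec_self v).symm

theorem quadRe_le_of_le {M N : Matrix (Fin n) (Fin n) ℂ} (h : M ≤ N) (v : Fin n → ℂ) :
    quadRe M v ≤ quadRe N v := by
  rw [Matrix.le_iff] at h
  rw [← sub_nonneg, ← quadRe_sub]
  exact (Complex.nonneg_iff.mp (h.dotProduct_mulVec_nonneg v)).1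

theorem quadRe_one_pos {v : Fin n → ℂ} (hv : v ≠ 0) :
    0 < quadRe (1 : Matrix (Fin n) (Fin n) ℂ) v := by
  rw [quadRe, one_mulVec]
  exact (Complex.pos_iff.mp (dotProduct_star_self_pos_iff.mpr hv)).1

theorem quadRe_zero_vec (M : Matrix (Fin n) (Fin n) ℂ) : quadRe M 0 = 0 := by simp [quadRe]

theorem IsAccretive.quadRe_nonneg {M : Matrix (Fin n) (Fin n) ℂ} (hM : IsAccretive M)
    (v : Fin n → ℂ) : 0 ≤ quadRe M v := by
  rcases eq_or_ne v 0 with rfl | hv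
  · rw [quadRe_zero_vec]
  · exact (hM v hv).le

theorem isAccretive_one : IsAccretive (1 : Matrix (Fin n) (Fin n) ℂ) := fun _ => quadRe_one_pos

theorem IsAccretive.matRe {M : Matrix (Fin n) (Fin n) ℂ} (hM : IsAccretive M) :
    IsAccretive (matRe M) := fun v hv => by rw [quadRe_matRe]; exact hM v hv

theorem IsAccretive.combo {M N : Matrix (Fin n) (Fin n) ℂ} (hM : IsAccretive M)
    (hN : IsAccretive N) {a b : ℝ} (ha : 0 ≤ a) (hb : 0 ≤ b) (hab : a + b = 1) :
    IsAccretive (a • M + b • N) := fun v hv => by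
  rw [quadRe_add, quadRe_smul, quadRe_smul]
  have h1 := hM v hv
  have h2 := hN v hv
  rcases ha.eq_or_lt with rfl | ha
  · have : b = 1 := by linarith
    subst this; linarith
  · have := mul_pos ha h1
    have := mul_nonneg hb h2.le
    linarith

theorem IsAccretive.add_smul_one {M : Matrix (Fin n) (Fin n) ℂ} (hM : IsAccretive M)
    {c : ℝ} (hc : 0 ≤ c) : IsAccretive (M + c • 1) := fun v hv => by
  rw [quadRe_add, quadRe_smul]
  have h1 := hM v hv
  have := mul_nonneg hc (quadRe_one_pos hv).le
  linarith

theorem IsAccretive.isUnit {M : Matrix (Fin n) (Fin n) ℂ} (hM : IsAccretive M) : IsUnit M := by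
  rw [← mulVec_injective_iff_isUnit]
  refine (injective_iff_map_eq_zero M.mulVecLin).mpr fun v hv => ?_
  by_contra hne
  have := hM v hne
  rw [mulVecLin_apply] at hv
  rw [quadRe, hv] at this
  simp at this

theorem mulVec_inv_cancel {M : Matrix (Fin n) (Fin n) ℂ} (hM : IsUnit M) (v : Fin n → ℂ) :
    M *ᵥ (M⁻¹ *ᵥ v) = v := by
  rw [mulVec_mulVec, mul_nonsing_inv _ ((isUnit_iff_isUnit_det _).mp hM), one_mulVec]

theorem quadRe_inv {M : Matrix (Fin n) (Fin n) ℂ} (hM : IsUnit M) (v : Fin n → ℂ) :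
    quadRe M⁻¹ v = quadRe M (M⁻¹ *ᵥ v) := by
  rw [quadRe, quadRe, mulVec_inv_cancel hM, re_star_dotProduct_comm]

theorem IsAccretive.inv {M : Matrix (Fin n) (Fin n) ℂ} (hM : IsAccretive M) :
    IsAccretive M⁻¹ := fun v hv => by
  rw [quadRe_inv hM.isUnit]
  refine hM _ fun h => hv ?_
  rw [← mulVec_inv_cancel hM.isUnit v, h, mulVec_zero]

/-- Young's inequality for a positive definite matrix. -/
theorem two_mul_re_dotProduct_le {P : Matrix (Fin n) (Fin n) ℂ} (hP : IsAccretive P)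
    (hPH : P.IsHermitian) (w x : Fin n → ℂ) :
    2 * (star w ⬝ᵥ x).re ≤ quadRe P x + quadRe P⁻¹ w := by
  have h := hP.quadRe_nonneg (x - P⁻¹ *ᵥ w)
  have h1 : star (P⁻¹ *ᵥ w) ⬝ᵥ P *ᵥ x = star w ⬝ᵥ x := by
    have := star_mulVec_dotProduct P (P⁻¹ *ᵥ w) x
    rw [hPH.eq, mulVec_inv_cancel hP.isUnit] at this
    exact this.symm
  simp only [quadRe, mulVec_sub, mulVec_inv_cancel hP.isUnit, star_sub, sub_dotProduct,
    dotProduct_sub, Complex.sub_re, h1] at h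
  rw [re_star_dotProduct_comm x w, re_star_dotProduct_comm _ w] at h
  simp only [quadRe]
  linarith

/-- Cauchy-Schwarz for the skew-Hermitian part of a sectorial matrix. -/
theorem re_dotProduct_skew_le {A N : Matrix (Fin n) (Fin n) ℂ} (hN : Nᴴ = -N)
    (hAN : matRe A = A - N) {T : ℝ} (hs : ∀ v, |(star v ⬝ᵥ A *ᵥ v).im| ≤ T * quadRe A v)
    (x y : Fin n → ℂ) (s : ℝ) :
    2 * (s * (star y ⬝ᵥ N *ᵥ x).re) ≤ T * (quadRe A y + s ^ 2 * quadRe A x) := by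
  have hP : ∀ v, (star v ⬝ᵥ A *ᵥ v).im = (star v ⬝ᵥ N *ᵥ v).im := fun v => by
    have h1 := (isHermitian_matRe A).im_star_dotProduct_mulVec_self v
    rw [hAN, sub_mulVec, dotProduct_sub, map_sub] at h1
    exact sub_eq_zero.mp h1
  have hc : star x ⬝ᵥ N *ᵥ y = -star (star y ⬝ᵥ N *ᵥ x) := by
    have := star_mulVec_dotProduct N x y
    rw [hN, neg_mulVec, dotProduct_neg] at this
    rw [← neg_eq_iff_eq_neg, ← this, star_dotProduct]
  -- Polarization: since N is skew-Hermitian, the cross term of its form at y ± isx is ±2is Re⟨Nx,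
  -- y⟩. Subtracting the two sector bounds isolates it, and the real forms add up by the
  -- parallelogram law.
  have h1 := hs (y + (s * Complex.I) • x)
  have h2 := hs (y - (s * Complex.I) • x)
  rw [hP, abs_le] at h1 h2
  have h3 := h1.2
  have h4 := h2.1
  simp only [quadRe, mulVec_add, mulVec_sub, mulVec_smul, star_add, star_sub, star_smul,
    add_dotProduct, sub_dotProduct, dotProduct_add, dotProduct_sub, smul_dotProduct,
    dotProduct_smul, smul_eq_mul, hc] at h3 h4
  simp only [Complex.add_re, Complex.add_im, Complex.sub_re, Complex.sub_im, Complex.mul_re,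
    Complex.mul_im, Complex.ofReal_re, Complex.ofReal_im, Complex.I_re, Complex.I_im,
    Complex.neg_re, Complex.neg_im, RCLike.star_def, Complex.conj_re, Complex.conj_im, map_mul,
    Complex.conj_ofReal, Complex.conj_I] at h3 h4
  simp only [quadRe]
  ring_nf at h3 h4 ⊢
  linarith

/-- The real part of `A⁻¹` dominates a multiple of the inverse of the real part when the numerical
range of `A` lies in a sector. -/
theorem quadRe_inv_matRe_le {A : Matrix (Fin n) (Fin n) ℂ} (hA : IsAccretive A) {T : ℝ}
    (hT : 0 ≤ T) (hs : ∀ v, |(star v ⬝ᵥ A *ᵥ v).im| ≤ T * quadRe A v) (v : Fin n → ℂ) :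
    quadRe (matRe A)⁻¹ v ≤ (1 + T ^ 2) * quadRe A⁻¹ v := by
  obtain ⟨N, hAN⟩ : ∃ N, matRe A = A - N := ⟨A - matRe A, by abel⟩
  have hN' : N = A - matRe A := by rw [hAN]; abel
  have hN : Nᴴ = -N := by
    rw [hN', conjTranspose_sub, (isHermitian_matRe A).eq, matRe_eq]
    module
  have hv := mulVec_inv_cancel hA.isUnit v
  rw [quadRe_inv hA.isUnit]
  set x := A⁻¹ *ᵥ v
  -- Chosen so that v = Ax = (Re A)(x + y). Then the form of (Re A)⁻¹ at v is that of Re A at x + y,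
  -- where the cross terms vanish because N is skew-Hermitian.
  set y := (matRe A)⁻¹ *ᵥ (N *ᵥ x) with hy
  have hPy : matRe A *ᵥ y = N *ᵥ x := mulVec_inv_cancel hA.matRe.isUnit _
  have hvx : v = matRe A *ᵥ (x + y) := by
    rw [mulVec_add, hPy, ← add_mulVec, hAN, sub_add_cancel, hv]
  have h1 : quadRe (matRe A)⁻¹ v = quadRe (matRe A) (x + y) := by
    rw [quadRe_inv hA.matRe.isUnit, hvx, mulVec_mulVec,
      nonsing_inv_mul _ ((isUnit_iff_isUnit_det _).mp hA.matRe.isUnit), one_mulVec]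
  have hq : quadRe A y = (star y ⬝ᵥ N *ᵥ x).re := by rw [← quadRe_matRe, quadRe, hPy]
  have h0 : (star x ⬝ᵥ N *ᵥ x).re = 0 := by
    have h3 : quadRe N x = 0 := by rw [hN', quadRe_sub, quadRe_matRe, sub_self]
    exact h3
  have h2 : quadRe (matRe A) (x + y) = quadRe A x + quadRe A y := by
    have h5 : (star y ⬝ᵥ matRe A *ᵥ x).re = 0 := by
      rw [re_star_dotProduct_comm, star_mulVec_dotProduct, (isHermitian_matRe A).eq, hPy, h0]
    rw [← quadRe_matRe A x, ← quadRe_matRe A y]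
    simp only [quadRe, mulVec_add, star_add, add_dotProduct, dotProduct_add, Complex.add_re, h5,
      hPy, h0]
    ring
  -- The form at y equals the real part of ⟨Nx, y⟩, so the Cauchy-Schwarz bound with s = T contains
  -- it on both sides. For T = 0 any s works.
  have h6 : quadRe A y ≤ T ^ 2 * quadRe A x := by
    rcases hT.eq_or_lt with rfl | hT
    · have := re_dotProduct_skew_le hN hAN hs x y 1
      rw [← hq] at this
      linarith
    · have := re_dotProduct_skew_le hN hAN hs x y T
      rw [← hq] at this
      refine le_of_mul_le_mul_left (a := T) ?_ hT
      linarith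
  rw [h1, h2]
  linarith

/-! ### Harmonic means: variational principle and comparison with real parts. -/

/-- The weighted harmonic mean `(a X⁻¹ + b Y⁻¹)⁻¹`. -/
noncomputable def harmMean (a b : ℝ) (X Y : Matrix (Fin n) (Fin n) ℂ) : Matrix (Fin n) (Fin n) ℂ :=
  (a • X⁻¹ + b • Y⁻¹)⁻¹

section

variable {a b : ℝ} (ha : 0 ≤ a) (hb : 0 ≤ b) (hab : a + b = 1)
include ha hb hab

theorem IsAccretive.harmMean {X Y : Matrix (Fin n) (Fin n) ℂ} (hX : IsAccretive X)
    (hY : IsAccretive Y) : IsAccretive (harmMean a b X Y) :=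
  (hX.inv.combo hY.inv ha hb hab).inv

/-- Half of the variational principle, by duality: Young's inequality is applied to P and x and to Q
and y with the common dual vector w = (aP⁻¹ + bQ⁻¹)v′, in which the inner matrix is inverted and v′
= ax + by. -/
theorem quadRe_harmMean_le {P Q : Matrix (Fin n) (Fin n) ℂ} (hP : IsAccretive P)
    (hPH : P.IsHermitian) (hQ : IsAccretive Q) (hQH : Q.IsHermitian) (x y : Fin n → ℂ) :
    quadRe (harmMean a b P Q) (a • x + b • y) ≤ a * quadRe P x + b * quadRe Q y := by
  have hM := hP.inv.combo hQ.inv ha hb hab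
  set v := a • x + b • y with hv
  set w := (a • P⁻¹ + b • Q⁻¹)⁻¹ *ᵥ v with hw
  have h1 : quadRe (harmMean a b P Q) v = a * quadRe P⁻¹ w + b * quadRe Q⁻¹ w := by
    rw [harmMean, quadRe_inv hM.isUnit, quadRe_add, quadRe_smul, quadRe_smul]
  have h2 : quadRe (harmMean a b P Q) v = a * (star w ⬝ᵥ x).re + b * (star w ⬝ᵥ y).re := by
    rw [harmMean, quadRe, ← hw, re_star_dotProduct_comm, hv]
    simp
  have h3 := mul_le_mul_of_nonneg_left (two_mul_re_dotProduct_le hP hPH w x) ha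
  have h4 := mul_le_mul_of_nonneg_left (two_mul_re_dotProduct_le hQ hQH w y) hb
  linarith

/-- The optimal decomposition is x = X⁻¹w, y = Y⁻¹w with w = (aX⁻¹ + bY⁻¹)⁻¹v. The value formula
needs no Hermitian symmetry, which is what lets it serve sectorial matrices. -/
theorem exists_quadRe_harmMean_eq {X Y : Matrix (Fin n) (Fin n) ℂ} (hX : IsAccretive X)
    (hY : IsAccretive Y) (v : Fin n → ℂ) : ∃ x y : Fin n → ℂ, v = a • x + b • y ∧
      quadRe (harmMean a b X Y) v = a * quadRe X x + b * quadRe Y y := by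
  have hM := hX.inv.combo hY.inv ha hb hab
  refine ⟨X⁻¹ *ᵥ ((a • X⁻¹ + b • Y⁻¹)⁻¹ *ᵥ v), Y⁻¹ *ᵥ ((a • X⁻¹ + b • Y⁻¹)⁻¹ *ᵥ v), ?_, ?_⟩
  · conv_lhs => rw [← mulVec_inv_cancel hM.isUnit v]
    rw [add_mulVec, smul_mulVec, smul_mulVec]
  · rw [harmMean, quadRe_inv hM.isUnit, quadRe_add, quadRe_smul, quadRe_smul,
      quadRe_inv hX.isUnit, quadRe_inv hY.isUnit]

/-- The decomposition belonging to X and Y is a competitor in the minimum for their real parts. -/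
theorem quadRe_harmMean_matRe_le {X Y : Matrix (Fin n) (Fin n) ℂ} (hX : IsAccretive X)
    (hY : IsAccretive Y) (v : Fin n → ℂ) :
    quadRe (harmMean a b (matRe X) (matRe Y)) v ≤ quadRe (harmMean a b X Y) v := by
  obtain ⟨x, y, rfl, h⟩ := exists_quadRe_harmMean_eq ha hb hab hX hY v
  rw [h, ← quadRe_matRe X, ← quadRe_matRe Y]
  exact quadRe_harmMean_le ha hb hab hX.matRe (isHermitian_matRe X) hY.matRe
    (isHermitian_matRe Y) x y

/-- A minimum of a sum dominates the sum of the minima, and the harmonic mean of I with itself is I.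
-/
theorem quadRe_harmMean_add_le {P Q : Matrix (Fin n) (Fin n) ℂ} (hP : IsAccretive P)
    (hPH : P.IsHermitian) (hQ : IsAccretive Q) (hQH : Q.IsHermitian) {c : ℝ} (hc : 0 ≤ c)
    (v : Fin n → ℂ) :
    quadRe (harmMean a b P Q) v + c * quadRe 1 v ≤
      quadRe (harmMean a b (P + c • 1) (Q + c • 1)) v := by
  obtain ⟨x, y, rfl, h⟩ := exists_quadRe_harmMean_eq ha hb hab
    (hP.add_smul_one hc) (hQ.add_smul_one hc) v
  have h1 := quadRe_harmMean_le ha hb hab hP hPH hQ hQH x y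
  have h2 := quadRe_harmMean_le (n := n) ha hb hab isAccretive_one isHermitian_one
    isAccretive_one isHermitian_one x y
  have h3 : harmMean a b (1 : Matrix (Fin n) (Fin n) ℂ) 1 = 1 := by
    rw [harmMean, inv_one, ← add_smul, hab, one_smul, inv_one]
  rw [h3] at h2
  have h4 := mul_le_mul_of_nonneg_left h2 hc
  simp only [quadRe_add, quadRe_smul] at h
  rw [h]
  linarith

theorem quadRe_harmMean_le_matRe {A B : Matrix (Fin n) (Fin n) ℂ} (hA : IsAccretive A)
    (hB : IsAccretive B) {T : ℝ} (hT : 0 ≤ T)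
    (hsA : ∀ v, |(star v ⬝ᵥ A *ᵥ v).im| ≤ T * quadRe A v)
    (hsB : ∀ v, |(star v ⬝ᵥ B *ᵥ v).im| ≤ T * quadRe B v) (v : Fin n → ℂ) :
    (1 + T ^ 2)⁻¹ * quadRe (harmMean a b A B) v ≤
      quadRe (harmMean a b (matRe A) (matRe B)) v := by
  have hM := hA.inv.combo hB.inv ha hb hab
  have hN := hA.matRe.inv.combo hB.matRe.inv ha hb hab
  have hNH : (a • (matRe A)⁻¹ + b • (matRe B)⁻¹).IsHermitian :=
    (isHermitian_real_smul (isHermitian_matRe A).inv a).add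
      (isHermitian_real_smul (isHermitian_matRe B).inv b)
  set x := (a • A⁻¹ + b • B⁻¹)⁻¹ *ᵥ v with hx
  set c := (1 + T ^ 2)⁻¹ with hc
  have hc0 : 0 < c := by positivity
  -- With this c, the sectorial bound on the inverses makes the quadratic term at most c times the
  -- form of H(A, B), so half of the doubled linear term survives.
  have h1 := two_mul_re_dotProduct_le hN hNH v (c • x)
  have h2 : quadRe (harmMean a b A B) v = (star v ⬝ᵥ x).re := rfl
  have h3 : quadRe (harmMean a b A B) v = a * quadRe A⁻¹ x + b * quadRe B⁻¹ x := by
    rw [harmMean, quadRe_inv hM.isUnit, quadRe_add, quadRe_smul, quadRe_smul]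
  have h4 : quadRe (a • (matRe A)⁻¹ + b • (matRe B)⁻¹) (c • x) =
      c ^ 2 * (a * quadRe (matRe A)⁻¹ x + b * quadRe (matRe B)⁻¹ x) := by
    rw [← quadRe_smul a, ← quadRe_smul b, ← quadRe_add]
    simp [quadRe, mulVec_smul]
    ring
  have h5 := mul_le_mul_of_nonneg_left (quadRe_inv_matRe_le hA hT hsA x) ha
  have h6 := mul_le_mul_of_nonneg_left (quadRe_inv_matRe_le hB hT hsB x) hb
  have h7 : c * (1 + T ^ 2) = 1 := inv_mul_cancel₀ (by positivity)
  have h8 : c ^ 2 * (a * quadRe (matRe A)⁻¹ x + b * quadRe (matRe B)⁻¹ x) ≤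
      c * quadRe (harmMean a b A B) v := by
    rw [h3]
    calc _ ≤ c ^ 2 * (a * ((1 + T ^ 2) * quadRe A⁻¹ x) + b * ((1 + T ^ 2) * quadRe B⁻¹ x)) :=
          mul_le_mul_of_nonneg_left (by linarith) (by positivity)
      _ = c * (c * (1 + T ^ 2)) * (a * quadRe A⁻¹ x + b * quadRe B⁻¹ x) := by ring
      _ = _ := by rw [h7, mul_one]
  have h9 : (star v ⬝ᵥ (c • x)).re = c * quadRe (harmMean a b A B) v := by
    rw [h2]; simp
  rw [h9, h4] at h1
  change _ ≤ quadRe (a • (matRe A)⁻¹ + b • (matRe B)⁻¹)⁻¹ v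
  linarith

end

end QuadraticForm

/-! ### Matrix powers and the integral formula for the geometric mean. -/

section MatrixPower

/-- The `L∞` operator norm on matrices, with the product topology as its topology. -/
noncomputable abbrev matrixNormedRing (n : ℕ) : NormedRing (Matrix (Fin n) (Fin n) ℂ) where
  toRing := Matrix.instRing
  -- Replacing the topology makes it definitionally the one with which `NormedSpace.exp` is formed
  -- in `matPow`, so the Banach algebra results apply verbatim.
  toMetricSpace := (Matrix.linftyOpNormedRing (n := Fin n) (α := ℂ)).toMetricSpace.replaceTopology
      (U := instTopologicalSpaceMatrix) rfl
  toNorm := (Matrix.linftyOpNormedRing (n := Fin n) (α := ℂ)).toNorm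
  dist_eq := (Matrix.linftyOpNormedRing (n := Fin n) (α := ℂ)).dist_eq
  norm_mul_le := (Matrix.linftyOpNormedRing (n := Fin n) (α := ℂ)).norm_mul_le

attribute [local instance] matrixNormedRing

/-- The real normed algebra structure that goes with `matrixNormedRing`. -/
noncomputable abbrev matrixNormedAlgebra (n : ℕ) : NormedAlgebra ℝ (Matrix (Fin n) (Fin n) ℂ) where
  toAlgebra := Matrix.instAlgebra
  norm_smul_le := (Matrix.linftyOpNormedAlgebra (R := ℝ) (n := Fin n) (α := ℂ)).norm_smul_le

attribute [local instance] matrixNormedAlgebra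

variable {n : ℕ}

theorem completeSpace_matrix : CompleteSpace (Matrix (Fin n) (Fin n) ℂ) :=
  FiniteDimensional.complete ℝ _

attribute [local instance] completeSpace_matrix

/-- Taking an entry is continuous and linear, so it commutes with the matrix-valued integral. -/
theorem matLog_eq_segLog {X : Matrix (Fin n) (Fin n) ℂ}
    (h : ∀ u ∈ Icc (0 : ℝ) 1, IsUnit (1 + u • (X - 1))) : matLog X = segLog (X - 1) 1 := by
  ext i j
  have := (LinearMap.toContinuousLinearMap
    (Matrix.entryLinearMap ℝ ℂ i j)).intervalIntegral_comp_comm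
      (intervalIntegrable_mul_segInv h (r := 1) (by simp))
  simp only [LinearMap.coe_toContinuousLinearMap', Matrix.entryLinearMap_apply] at this
  rw [segLog, ← this, matLog, of_apply]
  simp only [segInv, nonsing_inv_eq_ringInverse]

theorem matPow_eq {X : Matrix (Fin n) (Fin n) ℂ}
    (h : ∀ u ∈ Icc (0 : ℝ) 1, IsUnit (1 + u • (X - 1))) (p : ℝ) :
    matPow X p = NormedSpace.exp (p • segLog (X - 1) 1) := by
  rw [matPow, matLog_eq_segLog h]

theorem matPow_zero (X : Matrix (Fin n) (Fin n) ℂ) : matPow X 0 = 1 := by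
  rw [matPow, zero_smul, NormedSpace.exp_zero]

theorem matPow_one {X : Matrix (Fin n) (Fin n) ℂ}
    (h : ∀ u ∈ Icc (0 : ℝ) 1, IsUnit (1 + u • (X - 1))) : matPow X 1 = X := by
  rw [matPow_eq h, one_smul, exp_segLog h, add_sub_cancel]

theorem matPow_add (X : Matrix (Fin n) (Fin n) ℂ) (p q : ℝ) :
    matPow X (p + q) = matPow X p * matPow X q := by
  let _ : NormedAlgebra ℚ (Matrix (Fin n) (Fin n) ℂ) :=
    NormedAlgebra.restrictScalars ℚ ℝ _
  rw [matPow, add_smul, NormedSpace.exp_add_of_commute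
    (((Commute.refl (matLog X)).smul_left p).smul_right q)]
  rfl

theorem one_add_smul_sub_one (u : ℝ) (X : Matrix (Fin n) (Fin n) ℂ) :
    1 + u • (X - 1) = (1 - u) • 1 + u • X := by
  module

theorem IsAccretive.isUnit_segment {A B : Matrix (Fin n) (Fin n) ℂ} (hA : IsAccretive A)
    (hB : IsAccretive B) {u : ℝ} (hu : u ∈ Icc (0 : ℝ) 1) : IsUnit ((1 - u) • A + u • B) :=
  (hA.combo hB (by linarith [hu.2]) hu.1 (by ring)).isUnit

theorem IsAccretive.isUnit_segment_one {A : Matrix (Fin n) (Fin n) ℂ} (hA : IsAccretive A) :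
    ∀ u ∈ Icc (0 : ℝ) 1, IsUnit (1 + u • (A - 1)) := fun u hu => by
  rw [one_add_smul_sub_one]
  exact isAccretive_one.isUnit_segment hA hu

section

variable {A B : Matrix (Fin n) (Fin n) ℂ} (hA : IsAccretive A) (hB : IsAccretive B)

theorem matPow_half_mul_neg_half (A : Matrix (Fin n) (Fin n) ℂ) :
    matPow A (1 / 2) * matPow A (-(1 / 2)) = 1 := by
  rw [← matPow_add, add_neg_cancel, matPow_zero]

theorem matPow_neg_half_mul_half (A : Matrix (Fin n) (Fin n) ℂ) :
    matPow A (-(1 / 2)) * matPow A (1 / 2) = 1 := by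
  rw [← matPow_add, neg_add_cancel, matPow_zero]

include hA in
theorem matPow_half_mul_half : matPow A (1 / 2) * matPow A (1 / 2) = A := by
  rw [← matPow_add, add_halves, matPow_one hA.isUnit_segment_one]

include hA in
theorem matPow_neg_half_sandwich :
    matPow A (-(1 / 2)) * A * matPow A (-(1 / 2)) = 1 := by
  have h : matPow A (-(1 / 2)) * (matPow A (1 / 2) * matPow A (1 / 2)) * matPow A (-(1 / 2)) =
      1 := by
    rw [← mul_assoc, matPow_neg_half_mul_half, one_mul, matPow_half_mul_neg_half]
  rwa [matPow_half_mul_half hA] at h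

include hA in
-- Multiplication by A^(-1/2) on both sides carries the segment from A to B to the one from I to
-- A^(-1/2) B A^(-1/2). Invertibility along the latter, hence its principal logarithm, follows
-- although that matrix need not be accretive.
theorem sandwich_segment (B : Matrix (Fin n) (Fin n) ℂ) (u : ℝ) :
    1 + u • (matPow A (-(1 / 2)) * B * matPow A (-(1 / 2)) - 1) =
      matPow A (-(1 / 2)) * ((1 - u) • A + u • B) * matPow A (-(1 / 2)) := by
  rw [one_add_smul_sub_one, mul_add, add_mul, mul_smul_comm, smul_mul_assoc,
    matPow_neg_half_sandwich hA, mul_smul_comm, smul_mul_assoc]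

include hA hB in
theorem isUnit_sandwich_segment :
    ∀ u ∈ Icc (0 : ℝ) 1, IsUnit (1 + u • (matPow A (-(1 / 2)) * B * matPow A (-(1 / 2)) - 1)) := by
  intro u hu
  have hS : IsUnit (matPow A (-(1 / 2))) :=
    ⟨⟨_, _, matPow_neg_half_mul_half A, matPow_half_mul_neg_half A⟩, rfl⟩
  rw [sandwich_segment hA]
  exact (hS.mul (hA.isUnit_segment hB hu)).mul hS

include hA in
theorem geomMean_zero (B : Matrix (Fin n) (Fin n) ℂ) : geomMean 0 A B = A := by
  rw [geomMean, matPow_zero, mul_one, matPow_half_mul_half hA]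

theorem half_conj_neg_half_conj (A M : Matrix (Fin n) (Fin n) ℂ) :
    matPow A (1 / 2) * (matPow A (-(1 / 2)) * M * matPow A (-(1 / 2))) * matPow A (1 / 2) = M := by
  calc _ = (matPow A (1 / 2) * matPow A (-(1 / 2))) * M *
      (matPow A (-(1 / 2)) * matPow A (1 / 2)) := by simp only [mul_assoc]
    _ = M := by rw [matPow_half_mul_neg_half, matPow_neg_half_mul_half, one_mul, mul_one]

include hA hB in
theorem geomMean_one : geomMean 1 A B = B := by
  rw [geomMean, matPow_one (isUnit_sandwich_segment hA hB), half_conj_neg_half_conj]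

include hA hB in
theorem harmMean_eq_mul (u : ℝ) :
    harmMean u (1 - u) A B = B * ((1 - u) • A + u • B)⁻¹ * A := by
  have hA' := (isUnit_iff_isUnit_det _).mp hA.isUnit
  have hB' := (isUnit_iff_isUnit_det _).mp hB.isUnit
  have h : u • A⁻¹ + (1 - u) • B⁻¹ = A⁻¹ * ((1 - u) • A + u • B) * B⁻¹ := by
    rw [mul_add, add_mul, mul_smul_comm, smul_mul_assoc, nonsing_inv_mul _ hA', one_mul,
      mul_smul_comm, smul_mul_assoc, mul_assoc, mul_nonsing_inv _ hB', mul_one, add_comm]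
  rw [harmMean, h, Matrix.mul_inv_rev, Matrix.mul_inv_rev, nonsing_inv_nonsing_inv _ hA',
    nonsing_inv_nonsing_inv _ hB', mul_assoc]

include hA hB in
-- This is the integrand of the power formula after multiplication by A^(1/2) on both sides: the
-- square roots cancel and B((1-u)A + uB)⁻¹A remains.
theorem half_conj_sandwich_resolvent (u : ℝ) :
    matPow A (1 / 2) * ((1 + (matPow A (-(1 / 2)) * B * matPow A (-(1 / 2)) - 1)) *
      segInv (matPow A (-(1 / 2)) * B * matPow A (-(1 / 2)) - 1) u) * matPow A (1 / 2) =
      harmMean u (1 - u) A B := by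
  have hinv : (matPow A (-(1 / 2)))⁻¹ = matPow A (1 / 2) :=
    inv_eq_right_inv (matPow_neg_half_mul_half A)
  have hR : segInv (matPow A (-(1 / 2)) * B * matPow A (-(1 / 2)) - 1) u =
      matPow A (1 / 2) * (((1 - u) • A + u • B)⁻¹ * matPow A (1 / 2)) := by
    rw [segInv, sandwich_segment hA, ← nonsing_inv_eq_ringInverse, Matrix.mul_inv_rev, Matrix.mul_inv_rev, hinv]
  rw [hR, add_sub_cancel, harmMean_eq_mul hA hB]
  calc _ = (matPow A (1 / 2) * matPow A (-(1 / 2))) * B *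
      (matPow A (-(1 / 2)) * matPow A (1 / 2)) * ((1 - u) • A + u • B)⁻¹ *
      (matPow A (1 / 2) * matPow A (1 / 2)) := by simp only [mul_assoc]
    _ = _ := by
      rw [matPow_half_mul_neg_half, matPow_neg_half_mul_half, one_mul, mul_one,
        matPow_half_mul_half hA]

/-- The quadratic form of a matrix at `v`, as a continuous linear functional. -/
noncomputable def quadReCLM (v : Fin n → ℂ) : Matrix (Fin n) (Fin n) ℂ →L[ℝ] ℝ :=
  LinearMap.toContinuousLinearMap
    { toFun := fun M => quadRe M v
      map_add' := fun M N => quadRe_add M N v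
      map_smul' := fun c M => quadRe_smul c M v }

theorem quadReCLM_apply (v : Fin n → ℂ) (M : Matrix (Fin n) (Fin n) ℂ) :
    quadReCLM v M = quadRe M v := rfl

include hA hB in
theorem continuousOn_harmMean :
    ContinuousOn (fun u => harmMean u (1 - u) A B) (Icc 0 1) := by
  refine ContinuousOn.congr ?_ fun u _ => (half_conj_sandwich_resolvent hA hB u).symm
  have := continuousOn_segInv (isUnit_sandwich_segment hA hB)
  fun_prop

include hA hB in
theorem intervalIntegrable_quadRe_harmMean {l : ℝ} (h0 : 0 < l) (h1 : l < 1) (v : Fin n → ℂ) :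
    IntervalIntegrable (fun u => betaWeight l u * quadRe (harmMean u (1 - u) A B) v)
      volume 0 1 :=
  intervalIntegrable_betaWeight_smul h0 h1 (f := fun u => quadRe (harmMean u (1 - u) A B) v)
    ((quadReCLM v).continuous.comp_continuousOn (continuousOn_harmMean hA hB))

include hA hB in
theorem betaMass_smul_geomMean {l : ℝ} (h0 : 0 < l) (h1 : l < 1) :
    betaMass l • geomMean l A B =
      ∫ u in (0 : ℝ)..1, betaWeight l u • harmMean u (1 - u) A B := by
  have hX := isUnit_sandwich_segment hA hB
  have key := exp_smul_segLog_eq_integral hX h0 h1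
  have hi : IntervalIntegrable (fun u => betaWeight l u •
      ((1 + (matPow A (-(1 / 2)) * B * matPow A (-(1 / 2)) - 1)) *
        segInv (matPow A (-(1 / 2)) * B * matPow A (-(1 / 2)) - 1) u)) volume 0 1 :=
    intervalIntegrable_betaWeight_smul h0 h1 (continuousOn_const.mul (continuousOn_segInv hX))
  have hc := (((ContinuousLinearMap.mul ℝ (Matrix (Fin n) (Fin n) ℂ)).flip
    (matPow A (1 / 2))).comp (ContinuousLinearMap.mul ℝ (Matrix (Fin n) (Fin n) ℂ)
      (matPow A (1 / 2)))).intervalIntegral_comp_comm hi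
  simp only [ContinuousLinearMap.comp_apply, ContinuousLinearMap.flip_apply,
    ContinuousLinearMap.mul_apply'] at hc
  rw [← key, mul_smul_comm, smul_mul_assoc, ← matPow_eq hX] at hc
  rw [geomMean, ← hc]
  refine intervalIntegral.integral_congr fun u hu => ?_
  rw [uIcc_of_le zero_le_one] at hu
  simp only [mul_smul_comm, smul_mul_assoc]
  rw [half_conj_sandwich_resolvent hA hB]

include hA hB in
theorem betaMass_mul_quadRe_geomMean {l : ℝ} (h0 : 0 < l) (h1 : l < 1) (v : Fin n → ℂ) :
    betaMass l * quadRe (geomMean l A B) v =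
      ∫ u in (0 : ℝ)..1, betaWeight l u * quadRe (harmMean u (1 - u) A B) v := by
  have hi := intervalIntegrable_betaWeight_smul h0 h1 (continuousOn_harmMean hA hB)
  have hc := (quadReCLM v).intervalIntegral_comp_comm hi
  rw [← betaMass_smul_geomMean hA hB h0 h1] at hc
  simp only [quadReCLM_apply, quadRe_smul] at hc
  exact hc.symm

end

end MatrixPower

/-! ### Scalar reverse inequality between weighted means. -/

section Scalar

/-- The power formula in the Banach algebra ℝ with D = d - 1. Using the same representation for
numbers and matrices makes the value of the mass irrelevant. -/
theorem integral_betaWeight_mul_div {d l : ℝ} (hd : 0 < d) (h0 : 0 < l) (h1 : l < 1) :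
    ∫ u in (0 : ℝ)..1, betaWeight l u * (d * (1 + u * (d - 1))⁻¹) = betaMass l * d ^ l := by
  have hu : ∀ u ∈ Icc (0 : ℝ) 1, IsUnit (1 + u • (d - 1)) := fun u hu => by
    rw [isUnit_iff_ne_zero, smul_eq_mul]
    have h2 := mul_nonneg hu.1 hd.le
    rcases hu.2.lt_or_eq with h | rfl
    · exact (by linarith : 0 < 1 + u * (d - 1)).ne'
    · simpa using hd.ne'
  have he := exp_segLog hu
  have key := exp_smul_segLog_eq_integral hu h0 h1
  rw [← Real.exp_eq_exp_ℝ] at he key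
  rw [add_sub_cancel] at he
  have hlog : segLog (d - 1) 1 = Real.log d := by
    rw [← Real.log_exp (segLog (d - 1) 1), he]
  rw [hlog, smul_eq_mul, smul_eq_mul, mul_comm l, ← Real.rpow_def_of_pos hd] at key
  rw [key]
  simp [segInv]

theorem weightedLog_pos {l x : ℝ} (h0 : 0 ≤ l) (h1 : l ≤ 1) (hx : 0 < x) :
    0 < 1 - l + l * x := by
  rcases h0.eq_or_lt with rfl | h0
  · norm_num
  · have := mul_pos h0 hx
    linarith

/-- The logarithm of the ratio of the weighted arithmetic to the weighted geometric mean of `1`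
and `x`. -/
noncomputable def logMeanRatio (l x : ℝ) : ℝ := Real.log (1 - l + l * x) - l * Real.log x

theorem hasDerivAt_logMeanRatio {l x : ℝ} (h0 : 0 ≤ l) (h1 : l ≤ 1) (hx : 0 < x) :
    HasDerivAt (logMeanRatio l) (l / (1 - l + l * x) - l / x) x := by
  have h := weightedLog_pos h0 h1 hx
  have h2 : HasDerivAt (fun y => 1 - l + l * y) l x := by
    simpa using ((hasDerivAt_id x).const_mul l).const_add (1 - l)
  refine ((h2.log h.ne').sub ((Real.hasDerivAt_log hx.ne').const_mul l)).congr_deriv ?_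
  rw [div_eq_mul_inv l x]

theorem monotoneOn_logMeanRatio {l : ℝ} (h0 : 0 ≤ l) (h1 : l ≤ 1) :
    MonotoneOn (logMeanRatio l) (Ici 1) := by
  have hd : ∀ x ∈ Ici (1 : ℝ), HasDerivAt (logMeanRatio l) (l / (1 - l + l * x) - l / x) x :=
    fun x hx => hasDerivAt_logMeanRatio h0 h1 (zero_lt_one.trans_le hx)
  refine monotoneOn_of_deriv_nonneg (convex_Ici 1)
    (fun x hx => (hd x hx).continuousAt.continuousWithinAt)
    (fun x hx => (hd x (interior_subset hx)).differentiableAt.differentiableWithinAt) ?_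
  intro x hx
  rw [interior_Ici, mem_Ioi] at hx
  rw [(hd x hx.le).deriv, sub_nonneg]
  refine div_le_div_of_nonneg_left h0 (weightedLog_pos h0 h1 (by linarith)) ?_
  nlinarith

theorem logMeanRatio_one (l : ℝ) : logMeanRatio l 1 = 0 := by simp [logMeanRatio]

/-- Both sides vanish at 1, and their difference has a derivative with the sign of
t(1-t)(1-2t)(x-1)². This is why the smaller of the two weights enters the constant. -/
theorem logMeanRatio_one_sub_le {t : ℝ} (h0 : 0 ≤ t) (h1 : t ≤ 1 - t) {x : ℝ} (hx : 1 ≤ x) :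
    logMeanRatio (1 - t) x ≤ logMeanRatio t x := by
  have ht1 : t ≤ 1 := by linarith
  have hd : ∀ x ∈ Ici (1 : ℝ), HasDerivAt (fun y => logMeanRatio t y - logMeanRatio (1 - t) y)
      (t / (1 - t + t * x) - t / x - ((1 - t) / (1 - (1 - t) + (1 - t) * x) - (1 - t) / x)) x :=
    fun x hx => (hasDerivAt_logMeanRatio h0 ht1 (zero_lt_one.trans_le hx)).sub
      (hasDerivAt_logMeanRatio (by linarith) (by linarith) (zero_lt_one.trans_le hx))
  have hm : MonotoneOn (fun y => logMeanRatio t y - logMeanRatio (1 - t) y) (Ici 1) := by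
    refine monotoneOn_of_deriv_nonneg (convex_Ici 1)
      (fun x hx => (hd x hx).continuousAt.continuousWithinAt)
      (fun x hx => (hd x (interior_subset hx)).differentiableAt.differentiableWithinAt) ?_
    intro x hx
    rw [interior_Ici, mem_Ioi] at hx
    rw [(hd x hx.le).deriv]
    have hx0 : 0 < x := by linarith
    have p1 := weightedLog_pos h0 ht1 hx0
    have p2 := weightedLog_pos (l := 1 - t) (by linarith) (by linarith) hx0
    have e : t / (1 - t + t * x) - t / x - ((1 - t) / (1 - (1 - t) + (1 - t) * x) - (1 - t) / x) =
        t * (1 - t) * ((x - 1) * (x - 1)) * (1 - t - t) /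
          (x * (1 - t + t * x) * (1 - (1 - t) + (1 - t) * x)) := by
      field_simp
      ring
    rw [e]
    refine div_nonneg (mul_nonneg (mul_nonneg (mul_nonneg h0 (by linarith))
      (mul_self_nonneg _)) (by linarith)) (by positivity)
  have := hm (mem_Ici.mpr le_rfl) (mem_Ici.mpr hx) hx
  simp only [logMeanRatio_one, sub_self] at this
  linarith

theorem logMeanRatio_le {l x K : ℝ} (h0 : 0 ≤ l) (h1 : l ≤ 1) (hx : 1 ≤ x) (hxK : x ≤ K) :
    logMeanRatio l x ≤ logMeanRatio (min l (1 - l)) K := by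
  have hK := hx.trans hxK
  refine (monotoneOn_logMeanRatio h0 h1 hx hK hxK).trans ?_
  rcases le_total l (1 - l) with h | h
  · rw [min_eq_left h]
  · rw [min_eq_right h]
    have := logMeanRatio_one_sub_le (t := 1 - l) (by linarith) (by linarith) hK
    rwa [sub_sub_cancel] at this

theorem exp_logMeanRatio {l x : ℝ} (h0 : 0 ≤ l) (h1 : l ≤ 1) (hx : 0 < x) :
    Real.exp (logMeanRatio l x) = (1 - l + l * x) / x ^ l := by
  rw [logMeanRatio, Real.exp_sub, Real.exp_log (weightedLog_pos h0 h1 hx),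
    Real.rpow_def_of_pos hx, mul_comm l (Real.log x)]

theorem meanRatio_le {l x K : ℝ} (h0 : 0 ≤ l) (h1 : l ≤ 1) (hx : 1 ≤ x) (hxK : x ≤ K) :
    (1 - l + l * x) / x ^ l ≤
      (1 - min l (1 - l) + min l (1 - l) * K) / K ^ min l (1 - l) := by
  rw [← exp_logMeanRatio h0 h1 (by linarith), ← exp_logMeanRatio (le_min h0 (by linarith))
    ((min_le_left _ _).trans h1) (by linarith)]
  exact Real.exp_le_exp.mpr (logMeanRatio_le h0 h1 hx hxK)

/-- By homogeneity the constant depends only on the ratio (k+μ)/(h+μ). -/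
theorem kantorovichConst_eq {h k μ : ℝ} (hh : 0 < h + μ) (hk : 0 < k + μ) {l : ℝ} :
    kantorovichConst h k μ l = ((1 - min l (1 - l) + min l (1 - l) * ((k + μ) / (h + μ))) /
      ((k + μ) / (h + μ)) ^ min l (1 - l))⁻¹ := by
  rw [kantorovichConst, realArithMean, realGeomMean]
  set t := min l (1 - l)
  rw [Real.inv_rpow hk.le, Real.inv_rpow hh.le, Real.div_rpow hk.le hh.le, Real.rpow_sub hk,
    Real.rpow_one]
  have h1 := Real.rpow_pos_of_pos hk t
  have h2 := Real.rpow_pos_of_pos hh t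
  field_simp

/-- The ratio of the means of 1 and d⁻¹ is bounded by its value at K = (k+μ)/(h+μ). If d ≤ 1, take x
= d⁻¹ with weight l; if d ≥ 1, exchange the two arguments and take x = d with weight 1 - l, which
leaves the minimum of the weights unchanged. -/
theorem kantorovichConst_mul_rpow_le {h k μ l d : ℝ} (hh : 0 < h + μ) (hk : 0 < k + μ)
    (h0 : 0 ≤ l) (h1 : l ≤ 1) (hd0 : 0 < d) (hd1 : d * (h + μ) ≤ k + μ)
    (hd2 : h + μ ≤ d * (k + μ)) :
    kantorovichConst h k μ l * d ^ l ≤ (1 - l + l * d⁻¹)⁻¹ := by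
  have hp := weightedLog_pos h0 h1 (inv_pos.mpr hd0)
  have hdl := Real.rpow_pos_of_pos hd0 l
  have key : (1 - l + l * d⁻¹) * d ^ l ≤ (1 - min l (1 - l) + min l (1 - l) *
      ((k + μ) / (h + μ))) / ((k + μ) / (h + μ)) ^ min l (1 - l) := by
    rcases le_total d 1 with hd | hd
    · have := meanRatio_le (l := l) (x := d⁻¹) (K := (k + μ) / (h + μ)) h0 h1
        ((one_le_inv₀ hd0).mpr hd) (by
          rw [le_div_iff₀ hh, inv_mul_le_iff₀ hd0]; exact hd2)
      rwa [Real.inv_rpow hd0.le, div_inv_eq_mul] at this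
    · have := meanRatio_le (l := 1 - l) (x := d) (K := (k + μ) / (h + μ)) (by linarith)
        (by linarith) hd (by rwa [le_div_iff₀ hh])
      rw [sub_sub_cancel, min_comm (1 - l) l, Real.rpow_sub hd0, Real.rpow_one] at this
      refine le_trans (le_of_eq ?_) this
      field_simp
      ring
  rw [kantorovichConst_eq hh hk]
  have hpos : 0 < (1 - l + l * d⁻¹) * d ^ l := mul_pos hp hdl
  have := inv_anti₀ hpos key
  refine (mul_le_mul_of_nonneg_right this hdl.le).trans (le_of_eq ?_)
  field_simp

theorem kantorovichConst_nonneg {h k μ : ℝ} (hh : 0 < h + μ) (hk : 0 < k + μ) {l : ℝ}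
    (h0 : 0 ≤ l) (h1 : l ≤ 1) : 0 ≤ kantorovichConst h k μ l := by
  rw [kantorovichConst_eq hh hk]
  have := (weightedLog_pos (le_min h0 (sub_nonneg.mpr h1)) ((min_le_left _ _).trans h1)
    (div_pos hk hh)).le
  positivity

theorem kantorovichConst_eq_one {h k μ : ℝ} (hh : 0 < h + μ) (hk : 0 < k + μ) {l : ℝ}
    (hl : min l (1 - l) = 0) : kantorovichConst h k μ l = 1 := by
  rw [kantorovichConst_eq hh hk, hl]
  simp

end Scalar

/-! ### Simultaneous diagonalization and the operator inequality. -/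

section Diagonalization

variable {n : ℕ}

theorem IsAccretive.posDef {P : Matrix (Fin n) (Fin n) ℂ} (hP : IsAccretive P)
    (hPH : P.IsHermitian) : P.PosDef :=
  PosDef.of_dotProduct_mulVec_pos hPH fun v hv =>
    Complex.pos_iff.mpr ⟨hP v hv, (hPH.im_star_dotProduct_mulVec_self v).symm⟩

theorem exists_unitary_diagonalization {T : Matrix (Fin n) (Fin n) ℂ} (hT : T.IsHermitian) :
    ∃ (U : Matrix (Fin n) (Fin n) ℂ) (d : Fin n → ℝ), U * Uᴴ = 1 ∧ Uᴴ * U = 1 ∧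
      T = U * diagonal (fun i => (d i : ℂ)) * Uᴴ := by
  refine ⟨hT.eigenvectorUnitary, hT.eigenvalues, ?_, ?_, ?_⟩
  · exact Unitary.coe_mul_star_self hT.eigenvectorUnitary
  · exact Unitary.coe_star_mul_self hT.eigenvectorUnitary
  · have hsp := hT.spectral_theorem
    rw [Unitary.conjStarAlgAut_apply] at hsp
    exact hsp

/-- Simultaneous diagonalization by congruence of a positive definite and a Hermitian matrix. -/
theorem exists_simultaneous_diagonalization {P Q : Matrix (Fin n) (Fin n) ℂ} (hP : IsAccretive P)
    (hPH : P.IsHermitian) (hQH : Q.IsHermitian) :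
    ∃ (S : Matrix (Fin n) (Fin n) ℂ) (d : Fin n → ℝ), IsUnit S ∧ P = Sᴴ * S ∧
      Q = Sᴴ * diagonal (fun i => (d i : ℂ)) * S := by
  have h0 := (hP.posDef hPH).posSemidef.nonneg
  obtain ⟨R, hR⟩ := CStarAlgebra.nonneg_iff_eq_star_mul_self.mp h0
  rw [star_eq_conjTranspose] at hR
  have hRu : IsUnit R.det := by
    have h1 := (isUnit_iff_isUnit_det _).mp hP.isUnit
    rw [hR, det_mul] at h1
    exact isUnit_of_mul_isUnit_right h1
  have hRR' := nonsing_inv_mul R hRu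
  -- With P = R*R, this congruence carries P to I, and a unitary diagonalizing the transformed Q
  -- leaves I fixed.
  have hT : (R⁻¹ᴴ * Q * R⁻¹).IsHermitian := isHermitian_conjTranspose_mul_mul _ hQH
  obtain ⟨U, d, hUU, hUU', hsp⟩ := exists_unitary_diagonalization hT
  have hUu : IsUnit Uᴴ := ⟨⟨Uᴴ, U, hUU', hUU⟩, rfl⟩
  refine ⟨Uᴴ * R, d, hUu.mul ((isUnit_iff_isUnit_det _).mpr hRu), ?_, ?_⟩
  · rw [conjTranspose_mul, conjTranspose_conjTranspose, mul_assoc, ← mul_assoc U, hUU, one_mul, hR]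
  · have h3 : Q = Rᴴ * (R⁻¹ᴴ * Q * R⁻¹) * R := by
      have h4 : Rᴴ * R⁻¹ᴴ = 1 := by rw [← conjTranspose_mul, hRR', conjTranspose_one]
      calc Q = (Rᴴ * R⁻¹ᴴ) * Q * (R⁻¹ * R) := by rw [h4, hRR', one_mul, mul_one]
        _ = _ := by simp only [mul_assoc]
    rw [hsp] at h3
    rw [conjTranspose_mul, conjTranspose_conjTranspose, h3]
    simp only [mul_assoc]

theorem quadRe_congruence (S D : Matrix (Fin n) (Fin n) ℂ) (v : Fin n → ℂ) :
    quadRe (Sᴴ * D * S) v = quadRe D (S *ᵥ v) := by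
  rw [quadRe, quadRe, star_mulVec_dotProduct, mulVec_mulVec, mulVec_mulVec, mul_assoc]

theorem quadRe_diagonal (d : Fin n → ℝ) (v : Fin n → ℂ) :
    quadRe (diagonal (fun i => (d i : ℂ))) v = ∑ i, d i * Complex.normSq (v i) := by
  rw [quadRe, dotProduct, Complex.re_sum]
  refine Finset.sum_congr rfl fun i _ => ?_
  rw [mulVec_diagonal]
  simp [Complex.normSq_apply]
  ring

theorem harmMean_congruence {a b : ℝ} {S : Matrix (Fin n) (Fin n) ℂ} (hS : IsUnit S)
    (d : Fin n → ℝ) (hd : ∀ i, 0 < d i) (ha : 0 ≤ a) (hb : 0 ≤ b) (hab : a + b = 1) :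
    harmMean a b (Sᴴ * S) (Sᴴ * diagonal (fun i => (d i : ℂ)) * S) =
      Sᴴ * diagonal (fun i => (((a + b * (d i)⁻¹)⁻¹ : ℝ) : ℂ)) * S := by
  have hSd := (isUnit_iff_isUnit_det _).mp hS
  have hSH : IsUnit Sᴴ.det := by rw [det_conjTranspose]; exact hSd.star
  have hpos : ∀ i, 0 < a + b * (d i)⁻¹ := fun i => by
    have := weightedLog_pos hb (by linarith) (inv_pos.mpr (hd i))
    rwa [← hab, add_sub_cancel_right] at this
  have hD : (diagonal (fun i => (d i : ℂ)))⁻¹ = diagonal (fun i => (((d i)⁻¹ : ℝ) : ℂ)) := by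
    refine inv_eq_right_inv ?_
    rw [diagonal_mul_diagonal, ← diagonal_one]
    congr 1
    ext i
    rw [← Complex.ofReal_mul, mul_inv_cancel₀ (hd i).ne', Complex.ofReal_one]
  have hE : (diagonal (fun i => ((a + b * (d i)⁻¹ : ℝ) : ℂ)))⁻¹ =
      diagonal (fun i => (((a + b * (d i)⁻¹)⁻¹ : ℝ) : ℂ)) := by
    refine inv_eq_right_inv ?_
    rw [diagonal_mul_diagonal, ← diagonal_one]
    congr 1
    ext i
    rw [← Complex.ofReal_mul, mul_inv_cancel₀ (hpos i).ne', Complex.ofReal_one]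
  have hF : diagonal (fun i => ((a + b * (d i)⁻¹ : ℝ) : ℂ)) =
      a • (1 : Matrix (Fin n) (Fin n) ℂ) + b • diagonal (fun i => (((d i)⁻¹ : ℝ) : ℂ)) := by
    ext i j
    rcases eq_or_ne i j with rfl | h
    · simp
    · simp [h]
  have hsum : a • (Sᴴ * S)⁻¹ + b • (Sᴴ * diagonal (fun i => (d i : ℂ)) * S)⁻¹ =
      S⁻¹ * (diagonal (fun i => ((a + b * (d i)⁻¹ : ℝ) : ℂ)) * Sᴴ⁻¹) := by
    rw [Matrix.mul_inv_rev, Matrix.mul_inv_rev, Matrix.mul_inv_rev, hD, hF, add_mul, mul_add,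
      smul_mul_assoc, smul_mul_assoc, mul_smul_comm, mul_smul_comm, one_mul]
  rw [harmMean, hsum, Matrix.mul_inv_rev, Matrix.mul_inv_rev, hE, nonsing_inv_nonsing_inv _ hSd,
    nonsing_inv_nonsing_inv _ hSH]

/-- The operator Kantorovich inequality between the harmonic mean and the integral
representation of the geometric mean. -/
theorem kantorovichConst_mul_integral_le {P Q : Matrix (Fin n) (Fin n) ℂ} (hPH : P.IsHermitian)
    (hQH : Q.IsHermitian) {h k μ : ℝ} (hh : 0 < h + μ) (hk : 0 < k + μ)
    (hP1 : ∀ v, (h + μ) * quadRe 1 v ≤ quadRe P v) (hP2 : ∀ v, quadRe P v ≤ (k + μ) * quadRe 1 v)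
    (hQ1 : ∀ v, (h + μ) * quadRe 1 v ≤ quadRe Q v) (hQ2 : ∀ v, quadRe Q v ≤ (k + μ) * quadRe 1 v)
    {l : ℝ} (h0 : 0 < l) (h1 : l < 1) (v : Fin n → ℂ) :
    kantorovichConst h k μ l *
        ∫ u in (0 : ℝ)..1, betaWeight l u * quadRe (harmMean u (1 - u) P Q) v ≤
      betaMass l * quadRe (harmMean (1 - l) l P Q) v := by
  have hP : IsAccretive P := fun v hv =>
    (mul_pos hh (quadRe_one_pos hv)).trans_le (hP1 v)
  obtain ⟨S, d, hS, rfl, rfl⟩ := exists_simultaneous_diagonalization hP hPH hQH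
  -- The vectors S⁻¹eᵢ have P-form 1 and Q-form dᵢ; the bounds on P and Q there confine dᵢ between
  -- (h+μ)/(k+μ) and its inverse.
  have hdv : ∀ i, ∃ w, w ≠ 0 ∧ quadRe (Sᴴ * S) w = 1 ∧
      quadRe (Sᴴ * diagonal (fun i => (d i : ℂ)) * S) w = d i := fun i => by
    have hw := mulVec_inv_cancel hS (Pi.single i 1)
    refine ⟨S⁻¹ *ᵥ Pi.single i 1, fun h0 => ?_, ?_, ?_⟩
    · rw [h0, mulVec_zero] at hw
      have := congrFun hw i
      simp at this
    · have := quadRe_congruence S 1 (S⁻¹ *ᵥ Pi.single i 1)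
      rw [mul_one] at this
      rw [this, hw]
      simp [quadRe]
    · rw [quadRe_congruence, hw, quadRe_diagonal]
      simp [Pi.single_apply, apply_ite]
  have hd : ∀ i, 0 < d i ∧ d i * (h + μ) ≤ k + μ ∧ h + μ ≤ d i * (k + μ) := fun i => by
    obtain ⟨w, hw0, hw1, hw2⟩ := hdv i
    have p := quadRe_one_pos hw0
    have a1 := hP1 w
    have a2 := hP2 w
    have a3 := hQ1 w
    have a4 := hQ2 w
    rw [hw1] at a1 a2
    rw [hw2] at a3 a4
    have hd0 : 0 < d i := (mul_pos hh p).trans_le a3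
    refine ⟨hd0, ?_, ?_⟩
    · refine (mul_le_mul_of_nonneg_right a4 hh.le).trans ?_
      rw [mul_assoc, mul_comm (quadRe _ _)]
      exact mul_le_of_le_one_right hk.le a1
    · have := mul_le_mul_of_nonneg_right a3 hk.le
      refine le_trans ?_ this
      rw [mul_assoc, mul_comm (quadRe _ _)]
      exact le_mul_of_one_le_right hh.le a2
  -- Harmonic means respect the congruence by S, so the integral splits into scalar Beta integrals
  -- and no matrix power of P or Q is needed.
  have hint : ∫ u in (0 : ℝ)..1, betaWeight l u * quadRe (harmMean u (1 - u) (Sᴴ * S)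
      (Sᴴ * diagonal (fun i => (d i : ℂ)) * S)) v =
      ∑ i, betaMass l * d i ^ l * Complex.normSq ((S *ᵥ v) i) := by
    have hc : ∀ i, ContinuousOn (fun u : ℝ => d i * (1 + u * (d i - 1))⁻¹) (Icc 0 1) := fun i => by
      refine continuousOn_const.mul (ContinuousOn.inv₀ (by fun_prop) fun u hu => ?_)
      have := weightedLog_pos hu.1 hu.2 (hd i).1
      exact (by linarith : 0 < 1 + u * (d i - 1)).ne'
    have e : ∀ i, betaMass l * d i ^ l * Complex.normSq ((S *ᵥ v) i) = ∫ u in (0 : ℝ)..1,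
        betaWeight l u * (d i * (1 + u * (d i - 1))⁻¹) * Complex.normSq ((S *ᵥ v) i) := fun i => by
      rw [intervalIntegral.integral_mul_const, integral_betaWeight_mul_div (hd i).1 h0 h1]
    simp only [e]
    have hi : ∀ i ∈ Finset.univ, IntervalIntegrable (fun u => betaWeight l u *
        (d i * (1 + u * (d i - 1))⁻¹) * Complex.normSq ((S *ᵥ v) i)) volume 0 1 := fun i _ =>
      (intervalIntegrable_betaWeight_smul h0 h1 (hc i)).mul_const _
    rw [← intervalIntegral.integral_finsetSum hi]
    refine intervalIntegral.integral_congr fun u hu => ?_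
    rw [uIcc_of_le zero_le_one] at hu
    rw [harmMean_congruence hS d (fun i => (hd i).1) hu.1 (by linarith [hu.2]) (by ring),
      quadRe_congruence, quadRe_diagonal, Finset.mul_sum]
    refine Finset.sum_congr rfl fun i _ => ?_
    have hdi := (hd i).1
    have h5 : (u + (1 - u) * (d i)⁻¹)⁻¹ = d i * (1 + u * (d i - 1))⁻¹ := by
      have e2 : u + (1 - u) * (d i)⁻¹ = (1 + u * (d i - 1)) / d i := by
        field_simp
        ring
      rw [e2, inv_div, div_eq_mul_inv]
    rw [h5, ← mul_assoc]
  rw [hint, harmMean_congruence hS d (fun i => (hd i).1) (by linarith) h0.le (by ring),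
    quadRe_congruence, quadRe_diagonal, Finset.mul_sum, Finset.mul_sum]
  refine Finset.sum_le_sum fun i _ => ?_
  have key := kantorovichConst_mul_rpow_le hh hk h0.le h1.le (hd i).1 (hd i).2.1 (hd i).2.2
  have h6 := mul_le_mul_of_nonneg_right key
    (mul_nonneg (betaMass_pos h0 h1).le (Complex.normSq_nonneg ((S *ᵥ v) i)))
  linarith

end Diagonalization

/-! ### From sectorial matrices to their shifted real parts. -/

section SectorialMeans

variable {n : ℕ}

theorem exists_normalize {v : Fin n → ℂ} (hv : v ≠ 0) : ∃ (r : ℝ) (w : Fin n → ℂ),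
    v = r • w ∧ star w ⬝ᵥ w = 1 := by
  have hp : 0 < quadRe (1 : Matrix (Fin n) (Fin n) ℂ) v := quadRe_one_pos hv
  set q := quadRe (1 : Matrix (Fin n) (Fin n) ℂ) v with hq
  have hs : 0 < √q := Real.sqrt_pos.mpr hp
  have hvq : star v ⬝ᵥ v = (q : ℂ) := by
    have := (isHermitian_one (n := Fin n) (α := ℂ)).im_star_dotProduct_mulVec_self v
    rw [one_mulVec] at this
    refine Complex.ext ?_ ?_
    · rw [hq, quadRe, one_mulVec, Complex.ofReal_re]
    · rw [Complex.ofReal_im]; exact this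
  refine ⟨√q, (√q)⁻¹ • v, ?_, ?_⟩
  · rw [smul_smul, mul_inv_cancel₀ hs.ne', one_smul]
  · rw [star_smul, smul_dotProduct, dotProduct_smul, hvq, star_trivial, smul_smul,
      ← mul_inv, Real.mul_self_sqrt hp.le, Complex.real_smul, ← Complex.ofReal_mul,
      inv_mul_cancel₀ hp.ne', Complex.ofReal_one]

theorem abs_im_le_of_mem_sectorialMatrices {α : ℝ} {A : Matrix (Fin n) (Fin n) ℂ}
    (hA : A ∈ sectorialMatrices n α) (v : Fin n → ℂ) :
    |(star v ⬝ᵥ A *ᵥ v).im| ≤ Real.tan α * quadRe A v := by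
  rcases eq_or_ne v 0 with rfl | hv
  · simp [quadRe]
  · obtain ⟨r, w, rfl, hw⟩ := exists_normalize hv
    have h := (hA ⟨w, hw, rfl⟩).2
    have e : star (r • w) ⬝ᵥ A *ᵥ (r • w) = (r * r) • (star w ⬝ᵥ A *ᵥ w) := by
      rw [mulVec_smul, star_smul, smul_dotProduct, dotProduct_smul, star_trivial, smul_smul]
    rw [quadRe, e, Complex.smul_re, Complex.smul_im, smul_eq_mul, smul_eq_mul, abs_mul,
      abs_mul_self]
    have := mul_le_mul_of_nonneg_left h (mul_self_nonneg r)
    linarith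

theorem resolventAverage_add_smul_one (μ l : ℝ) (A B : Matrix (Fin n) (Fin n) ℂ) :
    resolventAverage μ ![A, B] ![1 - l, l] + μ • 1 =
      harmMean (1 - l) l (A + μ • 1) (B + μ • 1) := by
  rw [resolventAverage, sub_add_cancel, harmMean, Fin.sum_univ_two]
  rfl

theorem cos_shiftedAngle_sq_le_one (α μ : ℝ) : Real.cos (shiftedAngle α μ) ^ 2 ≤ 1 :=
  Real.cos_sq_le_one _

theorem matRe_add_smul_one (M : Matrix (Fin n) (Fin n) ℂ) (c : ℝ) :
    matRe (M + c • 1) = matRe M + c • 1 := by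
  rw [matRe_eq, matRe_eq, conjTranspose_add, conjTranspose_smul, star_trivial, conjTranspose_one]
  module

section

variable {A B : Matrix (Fin n) (Fin n) ℂ} (hA : IsAccretive A) (hB : IsAccretive B)
include hA hB

theorem quadRe_geomMean_nonneg {l : ℝ} (h0 : 0 < l) (h1 : l < 1) (v : Fin n → ℂ) :
    0 ≤ quadRe (geomMean l A B) v := by
  refine nonneg_of_mul_nonneg_right ?_ (betaMass_pos h0 h1)
  rw [betaMass_mul_quadRe_geomMean hA hB h0 h1]
  refine intervalIntegral.integral_nonneg zero_le_one fun u hu => ?_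
  exact mul_nonneg (betaWeight_nonneg hu)
    ((hA.harmMean hu.1 (by linarith [hu.2]) (by ring) hB).quadRe_nonneg v)

/-- Pointwise under the integral: passing to real parts costs the factor 1/(1 + T²), and
superadditivity then absorbs μI into both arguments. -/
theorem betaMass_mul_quadRe_geomMean_add_le {T : ℝ} (hT : 0 ≤ T)
    (hsA : ∀ v, |(star v ⬝ᵥ A *ᵥ v).im| ≤ T * quadRe A v)
    (hsB : ∀ v, |(star v ⬝ᵥ B *ᵥ v).im| ≤ T * quadRe B v) {μ : ℝ} (hμ : 0 ≤ μ)
    {l : ℝ} (h0 : 0 < l) (h1 : l < 1) (v : Fin n → ℂ) :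
    betaMass l * ((1 + T ^ 2)⁻¹ * quadRe (geomMean l A B) v + μ * quadRe 1 v) ≤
      ∫ u in (0 : ℝ)..1, betaWeight l u *
        quadRe (harmMean u (1 - u) (matRe A + μ • 1) (matRe B + μ • 1)) v := by
  have i1 := (intervalIntegrable_quadRe_harmMean hA hB h0 h1 v).const_mul (1 + T ^ 2)⁻¹
  have i2 := (intervalIntegrable_betaWeight h0 h1).mul_const (μ * quadRe 1 v)
  have i3 := intervalIntegrable_quadRe_harmMean (hA.matRe.add_smul_one hμ)
    (hB.matRe.add_smul_one hμ) h0 h1 v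
  have e : betaMass l * ((1 + T ^ 2)⁻¹ * quadRe (geomMean l A B) v + μ * quadRe 1 v) =
      ∫ u in (0 : ℝ)..1, ((1 + T ^ 2)⁻¹ * (betaWeight l u * quadRe (harmMean u (1 - u) A B) v) +
        betaWeight l u * (μ * quadRe 1 v)) := by
    rw [intervalIntegral.integral_add i1 i2, intervalIntegral.integral_const_mul,
      intervalIntegral.integral_mul_const, ← betaMass_mul_quadRe_geomMean hA hB h0 h1, ← betaMass]
    ring
  rw [e]
  refine intervalIntegral.integral_mono_on zero_le_one (i1.add i2) i3 fun u hu => ?_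
  have hu1 : 0 ≤ 1 - u := by linarith [hu.2]
  have k1 := quadRe_harmMean_le_matRe hu.1 hu1 (by ring) hA hB hT hsA hsB v
  have k2 := quadRe_harmMean_add_le hu.1 hu1 (by ring) hA.matRe (isHermitian_matRe A) hB.matRe
    (isHermitian_matRe B) hμ v
  have k3 := mul_le_mul_of_nonneg_left
    ((add_le_add_left k1 (μ * quadRe 1 v)).trans k2) (betaWeight_nonneg (l := l) hu)
  linarith

end

end SectorialMeans

/-! ### Assembly of the inequality. -/

theorem mainTheorem9 (n : ℕ) (α : ℝ) (hα₀ : 0 ≤ α) (hα₁ : α < Real.pi / 2)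
    (A B : Matrix (Fin n) (Fin n) ℂ)
    (hA : A ∈ sectorialMatrices n α) (hB : B ∈ sectorialMatrices n α)
    (h k : ℝ) (hh : 0 < h) (hk : h < k)
    (hA₁ : h • (1 : Matrix (Fin n) (Fin n) ℂ) ≤ matRe A)
    (hA₂ : matRe A ≤ k • (1 : Matrix (Fin n) (Fin n) ℂ))
    (hB₁ : h • (1 : Matrix (Fin n) (Fin n) ℂ) ≤ matRe B)
    (hB₂ : matRe B ≤ k • (1 : Matrix (Fin n) (Fin n) ℂ))
    (μ : ℝ) (hμ : 0 ≤ μ) (l : ℝ) (hl₀ : 0 ≤ l) (hl₁ : l ≤ 1) :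
    (kantorovichConst h k μ l * Real.cos (shiftedAngle α μ) ^ 2) •
        (Real.cos α ^ 2 • matRe (geomMean l A B) + μ • (1 : Matrix (Fin n) (Fin n) ℂ)) ≤
      matRe (resolventAverage μ ![A, B] ![1 - l, l]) + μ • (1 : Matrix (Fin n) (Fin n) ℂ) := by
  have hcos : 0 < Real.cos α := Real.cos_pos_of_mem_Ioo ⟨by linarith [Real.pi_pos], hα₁⟩
  have hT : 0 ≤ Real.tan α := Real.tan_nonneg_of_nonneg_of_le_pi_div_two hα₀ hα₁.le
  have hT2 : (1 + Real.tan α ^ 2)⁻¹ = Real.cos α ^ 2 := Real.inv_one_add_tan_sq hcos.ne'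
  have hsA := abs_im_le_of_mem_sectorialMatrices hA
  have hsB := abs_im_le_of_mem_sectorialMatrices hB
  have low : ∀ {M : Matrix (Fin n) (Fin n) ℂ}, h • (1 : Matrix (Fin n) (Fin n) ℂ) ≤ matRe M →
      ∀ v, h * quadRe 1 v ≤ quadRe M v := fun {M} hM v => by
    rw [← quadRe_smul, ← quadRe_matRe M]; exact quadRe_le_of_le hM v
  have upp : ∀ {M : Matrix (Fin n) (Fin n) ℂ}, matRe M ≤ k • (1 : Matrix (Fin n) (Fin n) ℂ) →
      ∀ v, quadRe M v ≤ k * quadRe 1 v := fun {M} hM v => by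
    rw [← quadRe_smul, ← quadRe_matRe M]; exact quadRe_le_of_le hM v
  have hAa : IsAccretive A := fun v hv => (mul_pos hh (quadRe_one_pos hv)).trans_le (low hA₁ v)
  have hBa : IsAccretive B := fun v hv => (mul_pos hh (quadRe_one_pos hv)).trans_le (low hB₁ v)
  have hhμ : 0 < h + μ := by linarith
  have hkμ : 0 < k + μ := by linarith
  have hone : ∀ v : Fin n → ℂ, 0 ≤ quadRe 1 v := isAccretive_one.quadRe_nonneg
  have hC := kantorovichConst_nonneg hhμ hkμ hl₀ hl₁
  have hγ := cos_shiftedAngle_sq_le_one α μ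
  have hcos1 : Real.cos α ^ 2 ≤ 1 := Real.cos_sq_le_one α
  -- It suffices to prove the inequality without the factor `cos² γ`.
  suffices H : ∀ v, 0 ≤ quadRe (geomMean l A B) v ∧
      kantorovichConst h k μ l *
        (Real.cos α ^ 2 * quadRe (geomMean l A B) v + μ * quadRe 1 v) ≤
      quadRe (harmMean (1 - l) l (A + μ • 1) (B + μ • 1)) v by
    have hI : (μ • (1 : Matrix (Fin n) (Fin n) ℂ)).IsHermitian :=
      isHermitian_real_smul isHermitian_one μ
    refine le_of_quadRe_le (isHermitian_real_smul ((isHermitian_real_smul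
      (isHermitian_matRe _) _).add hI) _) ((isHermitian_matRe _).add hI) fun v => ?_
    rw [← matRe_add_smul_one, resolventAverage_add_smul_one]
    simp only [quadRe_smul, quadRe_add, quadRe_matRe]
    obtain ⟨H1, H2⟩ := H v
    refine le_trans ?_ H2
    refine mul_le_mul_of_nonneg_right (mul_le_of_le_one_right hC hγ) ?_
    exact add_nonneg (mul_nonneg (sq_nonneg _) H1) (mul_nonneg hμ (hone v))
  intro v
  -- The endpoints are separate because the Beta density is not integrable there; the means reduce
  -- to A or B and the constant to 1.
  rcases hl₀.eq_or_lt with rfl | hl0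
  · have e : harmMean (1 - 0) 0 (A + μ • 1) (B + μ • 1) = A + μ • 1 := by
      rw [harmMean, sub_zero, one_smul, zero_smul, add_zero, nonsing_inv_nonsing_inv _
        ((isUnit_iff_isUnit_det _).mp (hAa.add_smul_one hμ).isUnit)]
    rw [geomMean_zero hAa, e, quadRe_add, quadRe_smul, kantorovichConst_eq_one hhμ hkμ (by simp),
      one_mul]
    refine ⟨hAa.quadRe_nonneg v, add_le_add_left ?_ _⟩
    exact mul_le_of_le_one_left (hAa.quadRe_nonneg v) hcos1
  rcases hl₁.eq_or_lt with rfl | hl1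
  · have e : harmMean (1 - 1) 1 (A + μ • 1) (B + μ • 1) = B + μ • 1 := by
      rw [harmMean, sub_self, one_smul, zero_smul, zero_add, nonsing_inv_nonsing_inv _
        ((isUnit_iff_isUnit_det _).mp (hBa.add_smul_one hμ).isUnit)]
    rw [geomMean_one hAa hBa, e, quadRe_add, quadRe_smul,
      kantorovichConst_eq_one hhμ hkμ (by simp), one_mul]
    refine ⟨hBa.quadRe_nonneg v, add_le_add_left ?_ _⟩
    exact mul_le_of_le_one_left (hBa.quadRe_nonneg v) hcos1
  refine ⟨quadRe_geomMean_nonneg hAa hBa hl0 hl1 v, ?_⟩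
  have hm := betaMass_pos hl0 hl1
  have s1 := betaMass_mul_quadRe_geomMean_add_le hAa hBa hT hsA hsB hμ hl0 hl1 v
  rw [hT2] at s1
  have hH : ∀ M : Matrix (Fin n) (Fin n) ℂ, (matRe M + μ • 1).IsHermitian := fun M =>
    (isHermitian_matRe M).add (isHermitian_real_smul isHermitian_one μ)
  have hq : ∀ (M : Matrix (Fin n) (Fin n) ℂ) w,
      quadRe (matRe M + μ • 1) w = quadRe M w + μ * quadRe 1 w := fun M w => by
    rw [quadRe_add, quadRe_smul, quadRe_matRe]
  have s2 := kantorovichConst_mul_integral_le (hH A) (hH B) hhμ hkμ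
    (fun w => by rw [hq]; linarith [low hA₁ w]) (fun w => by rw [hq]; linarith [upp hA₂ w])
    (fun w => by rw [hq]; linarith [low hB₁ w]) (fun w => by rw [hq]; linarith [upp hB₂ w])
    hl0 hl1 v
  have s3 := quadRe_harmMean_matRe_le (sub_nonneg.mpr hl₁) hl₀ (by ring)
    (hAa.add_smul_one hμ) (hBa.add_smul_one hμ) v
  rw [matRe_add_smul_one, matRe_add_smul_one] at s3
  refine le_trans (le_of_mul_le_mul_left ?_ hm) s3
  refine le_trans ?_ s2
  rw [mul_left_comm]
  exact mul_le_mul_of_nonneg_left s1 hC
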